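/- Let $h\in\left(0,\frac{2}{3\sqrt6}\right)$. Then there is a unique $\alpha\in(0,\infty)$ with $$h=\frac{\sqrt2\,\cosh^2\alpha}{(1+2\cosh^2\alpha)^{3/2}}.$$ For this $\alpha$ put $$\psi_0=\frac{1}{\sqrt{2(1+2\cosh^2\alpha)}},\qquad A=\frac{\sqrt2\,\sinh\alpha}{\sqrt{1+2\cosh^2\alpha}},\qquad u_\pm(x)=\psi_0\left(1+\frac{2\sinh^2\alpha}{1\pm\cosh\alpha\,\cosh(Ax)}\right)\quad(x\in\mathbb R),$$ and for $u\in\{u_+,u_-\}$ consider in $L^2(\mathbb R;\mathbb C)$ the Schrödinger operators $$\mathcal L_+=-\partial_{xx}-6u^2+1,\qquad \mathcal L_-=-\partial_{xx}-2u^2+1 .$$ For a closed operator $S$ let $\sigma_{p.p.}(S)$ be the set of the isolated points of the spectrum $\sigma(S)$ that are eigenvalues of finite multiplicity, and let $\sigma_{ess.}(S)=\sigma(S)\setminus\sigma_{p.p.}(S)$; let $n(S)$ be the number of negative eigenvalues of $S$, counted with multiplicity; and write $S>0$ if $\langle Sf,f\rangle>0$ for all $f\neq0$ in the domain of $S$.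 Then, for both $u=u_+$ and $u=u_-$: * $\mathcal L_+$ and $\mathcal L_-$ are self-adjoint with domain $H^2(\mathbb R)$, and $\sigma_{ess.}(\mathcal L_\pm)\subset(0,\infty)$; * $u'\in H^2(\mathbb R)$ and $\mathcal L_+[u']=0$, and $0\in\sigma_{p.p.}(\mathcal L_+)$. Moreover: * for $u=u_+$: $n(\mathcal L_+)=1$ and $\mathcal L_->0$; * for $u=u_-$: $n(\mathcal L_+)=1$, $n(\mathcal L_-)=1$, and $0$ is not an eigenvalue of $\mathcal L_-$. -/

import Mathlib

open MeasureTheory Real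
open scoped SchwartzMap LineDeriv ENNReal ComplexInnerProductSpace

noncomputable section

namespace BBZ

/-! ### The solitons -/

/-- The pump strength `h` as a function of the parameter `α`. -/
def pump (α : ℝ) : ℝ :=
  √2 * cosh α ^ 2 / (1 + 2 * cosh α ^ 2) ^ (3 / 2 : ℝ)

/-- The limit `ψ₀` of the solitons at infinity. -/
def psi0 (α : ℝ) : ℝ := 1 / √(2 * (1 + 2 * cosh α ^ 2))

/-- The rate `A` in the profile of the solitons. -/
def rate (α : ℝ) : ℝ := √2 * sinh α / √(1 + 2 * cosh α ^ 2)

/-- The soliton `u₊`. -/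
def uPlus (α x : ℝ) : ℝ :=
  psi0 α * (1 + 2 * sinh α ^ 2 / (1 + cosh α * cosh (rate α * x)))

/-- The soliton `u₋`. -/
def uMinus (α x : ℝ) : ℝ :=
  psi0 α * (1 + 2 * sinh α ^ 2 / (1 - cosh α * cosh (rate α * x)))

/-! ### Schrödinger operators on `L²(ℝ; ℂ)` -/

/-- The Hilbert space `L²(ℝ; ℂ)`. -/
abbrev L2 : Type := Lp ℂ 2 (volume : Measure ℝ)

/-- The Sobolev space `H²(ℝ)`, as a subspace of `L²(ℝ; ℂ)`. -/
def H2 : Submodule ℂ L2 where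
  carrier := {f | TemperedDistribution.MemSobolev 2 2 (f : 𝓢'(ℝ, ℂ))}
  zero_mem' := by
    change TemperedDistribution.MemSobolev 2 2 (Lp.toTemperedDistributionCLM ℂ volume 2 (0 : L2))
    rw [map_zero]
    exact TemperedDistribution.memSobolev_fun_zero ℝ ℂ 2 2
  add_mem' {f g} hf hg := by
    change TemperedDistribution.MemSobolev 2 2 (Lp.toTemperedDistributionCLM ℂ volume 2 (f + g))
    rw [map_add]
    exact TemperedDistribution.MemSobolev.add hf hg
  smul_mem' c f hf := by
    change TemperedDistribution.MemSobolev 2 2 (Lp.toTemperedDistributionCLM ℂ volume 2 (c • f))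
    rw [map_smul]
    exact TemperedDistribution.MemSobolev.smul c hf

lemma toTemperedDistribution_injective :
    Function.Injective (Lp.toTemperedDistributionCLM ℂ (volume : Measure ℝ) 2) :=
  LinearMap.ker_eq_bot.1 Lp.ker_toTemperedDistributionCLM_eq_bot

lemma exists_secondDeriv (f : H2) :
    ∃ g : L2, (g : 𝓢'(ℝ, ℂ)) = ∂_{(1 : ℝ)} (∂_{(1 : ℝ)} ((f : L2) : 𝓢'(ℝ, ℂ))) := by
  have h := TemperedDistribution.MemSobolev.lineDerivOp (m := (1 : ℝ))
    (TemperedDistribution.MemSobolev.lineDerivOp (m := (1 : ℝ)) f.2)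
  have h2 : (2 : ℝ) - 1 - 1 = 0 := by norm_num
  rw [h2, TemperedDistribution.memSobolev_zero_iff] at h
  obtain ⟨g, hg⟩ := h
  exact ⟨g, hg.symm⟩

/-- The second derivative (in the sense of distributions) `∂ₓₓ : H²(ℝ) → L²(ℝ)`. -/
def secondDeriv : H2 →ₗ[ℂ] L2 where
  toFun f := (exists_secondDeriv f).choose
  map_add' f g := by
    apply toTemperedDistribution_injective
    rw [map_add]
    simp only [Lp.toTemperedDistributionCLM_apply]
    rw [(exists_secondDeriv (f + g)).choose_spec, (exists_secondDeriv f).choose_spec,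
      (exists_secondDeriv g).choose_spec, Submodule.coe_add,
      ← Lp.toTemperedDistributionCLM_apply, map_add, LineDeriv.lineDerivOp_add, LineDeriv.lineDerivOp_add]
    rfl
  map_smul' c f := by
    apply toTemperedDistribution_injective
    rw [map_smul]
    simp only [Lp.toTemperedDistributionCLM_apply, RingHom.id_apply]
    rw [(exists_secondDeriv (c • f)).choose_spec, (exists_secondDeriv f).choose_spec,
      Submodule.coe_smul, ← Lp.toTemperedDistributionCLM_apply, map_smul,
      LineDeriv.lineDerivOp_smul, LineDeriv.lineDerivOp_smul]
    rfl

lemma secondDeriv_spec (f : H2) :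
    ((secondDeriv f : L2) : 𝓢'(ℝ, ℂ)) = ∂_{(1 : ℝ)} (∂_{(1 : ℝ)} ((f : L2) : 𝓢'(ℝ, ℂ))) :=
  (exists_secondDeriv f).choose_spec

/-- The maximal domain of multiplication by the real potential `V` in `L²(ℝ; ℂ)`. -/
def mulDomain (V : ℝ → ℝ) : Submodule ℂ L2 where
  carrier := {f | MemLp (fun x => (V x : ℂ) * f x) 2 volume}
  zero_mem' := by
    refine (MemLp.zero (ε := ℂ)).ae_eq ?_
    filter_upwards [Lp.coeFn_zero ℂ 2 (volume : Measure ℝ)] with x hx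
    rw [hx]
    simp
  add_mem' {f g} hf hg := by
    refine (MemLp.add hf hg).ae_eq ?_
    filter_upwards [Lp.coeFn_add f g] with x hx
    rw [hx]
    simp [mul_add]
  smul_mem' c f hf := by
    refine (MemLp.const_smul hf c).ae_eq ?_
    filter_upwards [Lp.coeFn_smul c f] with x hx
    rw [hx]
    simp [mul_left_comm]

lemma memLp_of_mem_mulDomain {V : ℝ → ℝ} (f : mulDomain V) :
    MemLp (fun x => (V x : ℂ) * (f : L2) x) 2 volume := f.2

/-- Multiplication by the real potential `V`, on its maximal domain in `L²(ℝ; ℂ)`. -/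
def mulOp (V : ℝ → ℝ) : mulDomain V →ₗ[ℂ] L2 where
  toFun f := (memLp_of_mem_mulDomain f).toLp
  map_add' f g := by
    refine Eq.trans (MemLp.toLp_congr _
      ((memLp_of_mem_mulDomain f).add (memLp_of_mem_mulDomain g)) ?_) (MemLp.toLp_add _ _)
    filter_upwards [Lp.coeFn_add (f : L2) (g : L2)] with x hx
    rw [Submodule.coe_add, hx]
    simp [mul_add]
  map_smul' c f := by
    refine Eq.trans (MemLp.toLp_congr _
      ((memLp_of_mem_mulDomain f).const_smul c) ?_) (MemLp.toLp_const_smul _ _)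
    filter_upwards [Lp.coeFn_smul c (f : L2)] with x hx
    rw [Submodule.coe_smul, hx]
    simp [mul_left_comm]

/-- The Schrödinger operator `-∂ₓₓ + V` in `L²(ℝ; ℂ)`, on all `f ∈ H²(ℝ)` with `V f ∈ L²(ℝ)`. -/
def schrodinger (V : ℝ → ℝ) : L2 →ₗ.[ℂ] L2 where
  domain := H2 ⊓ mulDomain V
  toFun := -(secondDeriv ∘ₗ Submodule.inclusion inf_le_left)
    + mulOp V ∘ₗ Submodule.inclusion inf_le_right

/-- The linearized operator `𝓛₊ = -∂ₓₓ - 6 u² + 1`. -/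
def LPlus (u : ℝ → ℝ) : L2 →ₗ.[ℂ] L2 := schrodinger (fun x => -6 * u x ^ 2 + 1)

/-- The linearized operator `𝓛₋ = -∂ₓₓ - 2 u² + 1`. -/
def LMinus (u : ℝ → ℝ) : L2 →ₗ.[ℂ] L2 := schrodinger (fun x => -2 * u x ^ 2 + 1)

/-! ### Spectral notions for unbounded operators -/

section Spectral

variable {H : Type*} [NormedAddCommGroup H] [InnerProductSpace ℂ H]

/-- `z` is in the resolvent set of `A`: the operator `A - z`, from the domain of `A` to `H`, has a
bounded everywhere defined inverse `R`. -/
def IsResolventPoint (A : H →ₗ.[ℂ] H) (z : ℂ) : Prop :=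
  ∃ R : H →L[ℂ] H,
    (∀ y : H, ∃ hy : R y ∈ A.domain, A ⟨R y, hy⟩ - z • R y = y) ∧
    ∀ x : A.domain, R (A x - z • (x : H)) = x

/-- The spectrum of `A`. -/
def spec (A : H →ₗ.[ℂ] H) : Set ℂ := {z | ¬ IsResolventPoint A z}

/-- The eigenspace `Ker (A - z)`. -/
def eigenspace (A : H →ₗ.[ℂ] H) (z : ℂ) : Submodule ℂ H :=
  (LinearMap.ker (A.toFun - z • A.domain.subtype)).map A.domain.subtype

/-- `z` is an eigenvalue of `A`. -/
def IsEigenvalue (A : H →ₗ.[ℂ] H) (z : ℂ) : Prop := eigenspace A z ≠ ⊥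

/-- The pure point spectrum: the isolated points of the spectrum that are eigenvalues of finite
multiplicity. -/
def pointSpectrum (A : H →ₗ.[ℂ] H) : Set ℂ :=
  {z | IsEigenvalue A z ∧ FiniteDimensional ℂ (eigenspace A z) ∧
    ∃ r > 0, Metric.ball z r ∩ spec A ⊆ {z}}

/-- The essential spectrum: the rest of the spectrum. -/
def essentialSpectrum (A : H →ₗ.[ℂ] H) : Set ℂ := spec A \ pointSpectrum A

/-- The Morse index `n(A)`: the number of negative eigenvalues of `A`, counted with multiplicity.
It is `⊤` when there are infinitely many. -/
def morseIndex (A : H →ₗ.[ℂ] H) : ℕ∞ :=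
  ∑' μ : Set.Iio (0 : ℝ), Cardinal.toENat (Module.rank ℂ (eigenspace A ((μ : ℝ) : ℂ)))

/-- `A > 0`: the quadratic form of `A` is positive on every nonzero vector of the domain. -/
def IsPositiveOp (A : H →ₗ.[ℂ] H) : Prop :=
  ∀ f : A.domain, f ≠ 0 → 0 < (⟪A f, (f : H)⟫).re

end Spectral

end BBZ

end

/-! Everything is reduced to the sign of quadratic forms. Write `u = ψ₀ (1 + 2 q)`. The profile `q`
decays and `6ψ₀² + 4ψ₀² sinh² α = 1`, so the potentials of `𝓛₊` and `𝓛₋` tend to `1 - 6ψ₀²` and `1 -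
2ψ₀²`, both positive. A Poincaré inequality on a fine partition of a bounded interval then gives a
finite-rank `K` with `𝓛 + K ≥ δ > 0` (`exists_finiteRank_form_bound`). For a self-adjoint operator
this makes every point of the spectrum in `(-∞, 0]` an isolated eigenvalue of finite multiplicity
(`essentialSpectrum_subset`), and a negative value of the form forces a negative eigenvalue
(`exists_neg_eigenvalue`).

Lower bounds come from a solution of `p'' = W p`: the form density of `-∂ₓₓ + W` is `|f' - (p'/p)
f|²` minus the derivative of the flux `Re (f' f̄) - (p'/p)|f|²`, so only boundary terms matter where
`p` has no zero. For `𝓛₊`, differentiating the soliton equation shows that `p = q'` is admissible;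
its only zero is a simple one at the origin, so the form is nonnegative on functions vanishing
there. This is one linear condition, hence there is at most one negative direction. The test
function `q` supplies one, and `n(𝓛₊) = 1`. For `𝓛₋` at `u₊`, the function `p = u₊` is positive and
`-u'' - 2u³ + u` is a positive constant, which gives a strictly positive lower bound. For `𝓛₋` at
`u₋`, the potential exceeds that of `𝓛₊` by `4u² > 0` almost everywhere. Hence any two vectors have
a nontrivial combination that vanishes or has positive form: at most one eigenvalue `≤ 0`, counted
with multiplicity. The test function `q < 0` shows that it is negative, so `0` is not an eigenvalue.

Self-adjointness and the density of Schwartz functions rest on the bounded inverse of `1 - (2π)⁻²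
∂ₓₓ`, which maps `L²` onto `H²`. -/

noncomputable section

namespace BBZ

/-! ### Self-adjoint operators that are positive up to a finite-rank perturbation -/

section Abstract

open Filter Topology

variable {H : Type*} [NormedAddCommGroup H] [InnerProductSpace ℂ H] {A : H →ₗ.[ℂ] H}

/-- The operator `A - z` on the domain of `A`. -/
def shift (A : H →ₗ.[ℂ] H) (z : ℂ) : A.domain →ₗ[ℂ] H := A.toFun - z • A.domain.subtype

lemma shift_apply (z : ℂ) (f : A.domain) : shift A z f = A f - z • (f : H) := rfl

lemma mem_eigenspace_iff {z : ℂ} {x : H} :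
    x ∈ eigenspace A z ↔ ∃ hx : x ∈ A.domain, A ⟨x, hx⟩ = z • x := by
  simp only [eigenspace, Submodule.mem_map, LinearMap.mem_ker, Submodule.subtype_apply]
  constructor
  · rintro ⟨y, hy, rfl⟩
    exact ⟨y.2, sub_eq_zero.1 hy⟩
  · rintro ⟨hx, h⟩
    exact ⟨⟨x, hx⟩, sub_eq_zero.2 h, rfl⟩

lemma isEigenvalue_iff {z : ℂ} :
    IsEigenvalue A z ↔ ∃ x : A.domain, x ≠ 0 ∧ A x = z • (x : H) := by
  rw [IsEigenvalue, Submodule.ne_bot_iff]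
  constructor
  · rintro ⟨x, hx, h0⟩
    obtain ⟨hx, h⟩ := mem_eigenspace_iff.1 hx
    exact ⟨⟨x, hx⟩, fun h => h0 (congrArg Subtype.val h), h⟩
  · rintro ⟨x, h0, h⟩
    exact ⟨x, mem_eigenspace_iff.2 ⟨x.2, h⟩, fun h => h0 (Subtype.ext h)⟩

lemma re_inner_eigenvector {s : ℝ} {f : A.domain} (hf : A f = (s : ℂ) • (f : H)) :
    (inner ℂ (A f) (f : H)).re = s * ‖(f : H)‖ ^ 2 := by
  have e1 : (inner ℂ (f : H) (f : H)) = ((‖(f : H)‖ ^ 2 : ℝ) : ℂ) := by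
    rw [inner_self_eq_norm_sq_to_K]; push_cast; rfl
  rw [hf, inner_smul_left, e1, Complex.conj_ofReal, ← Complex.ofReal_mul, Complex.ofReal_re]

lemma re_inner_shift (t : ℝ) (f : A.domain) :
    (inner ℂ (shift A t f) (f : H)).re = (inner ℂ (A f) (f : H)).re - t * ‖(f : H)‖ ^ 2 := by
  rw [shift_apply, inner_sub_left, inner_smul_left, Complex.sub_re, inner_self_eq_norm_sq_to_K]
  have : ((‖(f : H)‖ : ℂ) ^ 2) = ((‖(f : H)‖ ^ 2 : ℝ) : ℂ) := by push_cast; rfl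
  simp only [Complex.coe_algebraMap, this, Complex.conj_ofReal, ← Complex.ofReal_mul,
    Complex.ofReal_re]

variable {K : H →L[ℂ] H} {δ : ℝ}

/-- Subtracting `t ≤ 0` only raises the form of `A + K`, so it stays at least `δ`; Cauchy–Schwarz
turns the form bound into a norm bound. -/
lemma norm_le_shift_add (hδ : ∀ f : A.domain,
      δ * ‖(f : H)‖ ^ 2 ≤ (inner ℂ (A f + K f) (f : H)).re) {t : ℝ} (ht : t ≤ 0) (f : A.domain) :
    δ * ‖(f : H)‖ ≤ ‖shift A t f + K f‖ := by
  have h1 : δ * ‖(f : H)‖ ^ 2 ≤ (inner ℂ (shift A t f + K f) (f : H)).re := by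
    have e : shift A t f + K f = A f + K f - (t : ℂ) • (f : H) := by rw [shift_apply]; abel
    rw [e, inner_sub_left, inner_smul_left, Complex.sub_re, inner_self_eq_norm_sq_to_K]
    have : ((‖(f : H)‖ : ℂ) ^ 2) = ((‖(f : H)‖ ^ 2 : ℝ) : ℂ) := by push_cast; rfl
    simp only [Complex.coe_algebraMap, this, Complex.conj_ofReal, ← Complex.ofReal_mul,
      Complex.ofReal_re]
    nlinarith [hδ f, sq_nonneg ‖(f : H)‖]
  have h2 : δ * ‖(f : H)‖ ^ 2 ≤ ‖shift A t f + K f‖ * ‖(f : H)‖ :=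
    h1.trans ((Complex.re_le_norm _).trans (norm_inner_le_norm _ _))
  rcases (norm_nonneg (f : H)).eq_or_lt with h | h
  · rw [← h]; simp
  · exact le_of_mul_le_mul_right (by nlinarith) h

/-- On the eigenspace `A - t` vanishes, so `δ ‖f‖ ≤ ‖K f‖`: the finite-rank `K` is injective there.
-/
lemma finiteDimensional_eigenspace [FiniteDimensional ℂ K.range] (hpos : 0 < δ)
    (hδ : ∀ f : A.domain, δ * ‖(f : H)‖ ^ 2 ≤ (inner ℂ (A f + K f) (f : H)).re)
    {t : ℝ} (ht : t ≤ 0) : FiniteDimensional ℂ (eigenspace A t) := by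
  let φ : eigenspace A t →ₗ[ℂ] K.range := K.toLinearMap.rangeRestrict ∘ₗ (eigenspace A t).subtype
  refine FiniteDimensional.of_injective φ ?_
  rw [← LinearMap.ker_eq_bot, LinearMap.ker_eq_bot']
  rintro ⟨f, hf⟩ h
  obtain ⟨hd, hf'⟩ := mem_eigenspace_iff.1 hf
  have hK : K f = 0 := congrArg Subtype.val h
  have := norm_le_shift_add hδ ht ⟨f, hd⟩
  rw [shift_apply, hf', hK] at this
  simp only [sub_self, add_zero, norm_zero] at this
  have h0 : ‖f‖ = 0 := le_antisymm (by nlinarith [norm_nonneg f]) (norm_nonneg _)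
  exact Subtype.ext (norm_eq_zero.1 h0)

/-! ### Resolvent, point spectrum and Morse index of a self-adjoint operator -/

variable [CompleteSpace H]

lemma inner_apply_left (hA : IsSelfAdjoint A) (x y : A.domain) :
    inner ℂ (A x) (y : H) = inner ℂ (x : H) (A y) := by
  have h := LinearPMap.adjoint_isFormalAdjoint hA.dense_domain
  rw [LinearPMap.isSelfAdjoint_def.1 hA] at h
  exact h x y

/-- The hypothesis places `y` in the domain of the adjoint with image `w`, and the adjoint is `A`.
-/
lemma mem_domain_of_inner (hA : IsSelfAdjoint A) {y w : H}
    (h : ∀ x : A.domain, inner ℂ w (x : H) = inner ℂ y (A x)) :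
    ∃ hy : y ∈ A.domain, A ⟨y, hy⟩ = w := by
  have hy : y ∈ A.adjoint.domain := LinearPMap.mem_adjoint_domain_of_exists y ⟨w, h⟩
  have key := LinearPMap.adjoint_apply_eq hA.dense_domain ⟨y, hy⟩ h
  have hle : A.adjoint ≤ A := (LinearPMap.isSelfAdjoint_def.1 hA).le
  exact ⟨hle.1 hy, by rw [← key]; exact (hle.2 (x := ⟨y, hy⟩) (y := ⟨y, hle.1 hy⟩) rfl).symm⟩

/-- A self-adjoint operator is closed: symmetry passes to the limit in the inner products. -/
lemma mem_domain_of_tendsto (hA : IsSelfAdjoint A) {f : ℕ → A.domain} {x y : H}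
    (hf : Tendsto (fun n => (f n : H)) atTop (𝓝 x)) (hAf : Tendsto (fun n => A (f n)) atTop (𝓝 y)) :
    ∃ hx : x ∈ A.domain, A ⟨x, hx⟩ = y := by
  refine mem_domain_of_inner hA fun v => ?_
  refine tendsto_nhds_unique (hAf.inner tendsto_const_nhds) ?_
  simp_rw [inner_apply_left hA]
  exact hf.inner tendsto_const_nhds

lemma tendsto_of_shift_cauchy (hA : IsSelfAdjoint A) {z : ℂ} {f : ℕ → A.domain} {y : H}
    (hf : CauchySeq (fun n => (f n : H))) (hy : Tendsto (fun n => shift A z (f n)) atTop (𝓝 y)) :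
    ∃ x : A.domain, Tendsto (fun n => (f n : H)) atTop (𝓝 (x : H)) ∧ shift A z x = y := by
  obtain ⟨x, hx⟩ := cauchySeq_tendsto_of_complete hf
  have h2 : Tendsto (fun n => A (f n)) atTop (𝓝 (y + z • x)) := by
    refine (hy.add (hx.const_smul z)).congr fun n => ?_
    simp [shift_apply]
  obtain ⟨hx', e⟩ := mem_domain_of_tendsto hA hx h2
  exact ⟨⟨x, hx'⟩, hx, by simp [shift_apply, e]⟩

/-- `A - z` is boundedly invertible if it is bounded below and `z̄` is not an eigenvalue. -/
lemma isResolventPoint_of_bound (hA : IsSelfAdjoint A) {z : ℂ} {c : ℝ} (hc : 0 < c)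
    (hb : ∀ f : A.domain, c * ‖(f : H)‖ ≤ ‖shift A z f‖)
    (hk : ∀ f : A.domain, A f = (starRingEnd ℂ) z • (f : H) → f = 0) :
    IsResolventPoint A z := by
  have hinj : Function.Injective (shift A z) := by
    rw [← LinearMap.ker_eq_bot, LinearMap.ker_eq_bot']
    intro f hf
    have := hb f
    rw [hf, norm_zero] at this
    have h0 : ‖(f : H)‖ = 0 := le_antisymm (by nlinarith [norm_nonneg (f : H)]) (norm_nonneg _)
    exact Subtype.ext (norm_eq_zero.1 h0)
  have hclosed : IsClosed ((shift A z).range : Set H) := by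
    refine isClosed_of_closure_subset fun y hy => ?_
    obtain ⟨u, hu, hlim⟩ := mem_closure_iff_seq_limit.1 hy
    choose f hf using hu
    have hcs : CauchySeq (fun n => (f n : H)) := by
      have hu := hlim.cauchySeq
      rw [Metric.cauchySeq_iff] at hu ⊢
      intro ε hε
      obtain ⟨N, hN⟩ := hu (c * ε) (by positivity)
      refine ⟨N, fun m hm n hn => ?_⟩
      have h1 := hN m hm n hn
      have h2 := hb (f m - f n)
      rw [map_sub, hf, hf, ← dist_eq_norm, Submodule.coe_sub, ← dist_eq_norm] at h2
      exact lt_of_mul_lt_mul_left (h2.trans_lt h1) hc.le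
    have hlim' : Tendsto (fun n => shift A z (f n)) atTop (𝓝 y) := by simpa only [hf] using hlim
    obtain ⟨x, -, hx⟩ := tendsto_of_shift_cauchy hA hcs hlim'
    exact ⟨x, hx⟩
  -- A vector orthogonal to the range lies in the domain of the adjoint and satisfies `A y = z̄ y`,
  -- so `hk` makes it zero.
  have hperp : (shift A z).rangeᗮ = ⊥ := by
    rw [Submodule.eq_bot_iff]
    intro y hy
    rw [Submodule.mem_orthogonal'] at hy
    have : ∀ x : A.domain, inner ℂ ((starRingEnd ℂ) z • y) (x : H) = inner ℂ y (A x) := by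
      intro x
      have := hy _ ⟨x, rfl⟩
      rw [shift_apply, inner_sub_right, sub_eq_zero, inner_smul_right] at this
      rw [this, inner_smul_left]
      simp
    obtain ⟨hy', e⟩ := mem_domain_of_inner hA this
    exact congrArg Subtype.val (hk ⟨y, hy'⟩ e)
  have hrange : (shift A z).range = ⊤ := by
    have := (Submodule.topologicalClosure_eq_top_iff (K := (shift A z).range)).2 hperp
    rwa [hclosed.submodule_topologicalClosure_eq] at this
  let e := LinearEquiv.ofBijective (shift A z) ⟨hinj, LinearMap.range_eq_top.1 hrange⟩
  have he : ∀ y, shift A z (e.symm y) = y := fun y => e.apply_symm_apply y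
  let R : H →L[ℂ] H := (A.domain.subtype ∘ₗ e.symm.toLinearMap).mkContinuous c⁻¹ fun y => by
    have := hb (e.symm y)
    rw [he] at this
    rw [inv_mul_eq_div, le_div_iff₀ hc, mul_comm]
    exact this
  refine ⟨R, fun y => ⟨(e.symm y).2, he y⟩, fun x => ?_⟩
  exact congrArg Subtype.val (e.symm_apply_apply x)

lemma inner_self_im (hA : IsSelfAdjoint A) (f : A.domain) : (inner ℂ (A f) (f : H)).im = 0 := by
  have h := inner_apply_left hA f f
  have h2 := inner_conj_symm (𝕜 := ℂ) (A f) (f : H)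
  rw [← h] at h2
  exact Complex.conj_eq_iff_im.1 h2

/-- The form of `A` is real, so the imaginary part of `⟨(A - z) f, f⟩` has modulus `|Im z| ‖f‖²`. -/
lemma im_mul_norm_le (hA : IsSelfAdjoint A) (z : ℂ) (f : A.domain) :
    |z.im| * ‖(f : H)‖ ≤ ‖shift A z f‖ := by
  have h1 : (inner ℂ (shift A z f) (f : H)).im = z.im * ‖(f : H)‖ ^ 2 := by
    rw [shift_apply, inner_sub_left, inner_smul_left, Complex.sub_im, inner_self_im hA,
      inner_self_eq_norm_sq_to_K]
    have : ((‖(f : H)‖ : ℂ) ^ 2) = ((‖(f : H)‖ ^ 2 : ℝ) : ℂ) := by push_cast; rfl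
    simp only [Complex.coe_algebraMap, this, Complex.im_mul_ofReal, Complex.conj_im]
    ring
  have h2 : |z.im| * ‖(f : H)‖ ^ 2 ≤ ‖shift A z f‖ * ‖(f : H)‖ := by
    calc |z.im| * ‖(f : H)‖ ^ 2 = |(inner ℂ (shift A z f) (f : H)).im| := by
          rw [h1, abs_mul, abs_of_nonneg (sq_nonneg ‖(f : H)‖)]
      _ ≤ ‖inner ℂ (shift A z f) (f : H)‖ := Complex.abs_im_le_norm _
      _ ≤ _ := norm_inner_le_norm _ _
  rcases (norm_nonneg (f : H)).eq_or_lt with h | h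
  · rw [← h]; simp
  · exact le_of_mul_le_mul_right (by nlinarith) h

lemma isResolventPoint_of_im_ne_zero (hA : IsSelfAdjoint A) {z : ℂ} (hz : z.im ≠ 0) :
    IsResolventPoint A z := by
  refine isResolventPoint_of_bound hA (abs_pos.2 hz) (im_mul_norm_le hA z) fun f hf => ?_
  have h := im_mul_norm_le hA ((starRingEnd ℂ) z) f
  rw [shift_apply, hf, sub_self, norm_zero, Complex.conj_im, abs_neg] at h
  have : ‖(f : H)‖ = 0 :=
    le_antisymm (by nlinarith [norm_nonneg (f : H), abs_pos.2 hz]) (norm_nonneg _)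
  exact Subtype.ext (norm_eq_zero.1 this)

/-- `A - t` is bounded below on the orthogonal complement of its kernel. -/
lemma exists_bound_on_orthogonal (hA : IsSelfAdjoint A) [FiniteDimensional ℂ K.range] (hpos : 0 < δ)
    (hδ : ∀ f : A.domain, δ * ‖(f : H)‖ ^ 2 ≤ (inner ℂ (A f + K f) (f : H)).re)
    {t : ℝ} (ht : t ≤ 0) :
    ∃ c > 0, ∀ f : A.domain, (f : H) ∈ (eigenspace A t)ᗮ → c * ‖(f : H)‖ ≤ ‖shift A t f‖ := by
  -- Otherwise unit vectors `f n` in the complement satisfy `(A - t) f n → 0`. Finite rank makes `K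
  -- (f n)` converge along a subsequence, the bound on `A - t + K` then makes `f n` Cauchy, and
  -- closedness puts its unit limit both in the eigenspace and in its complement.
  by_contra! hcon
  have hseq : ∀ n : ℕ, ∃ f : A.domain, (f : H) ∈ (eigenspace A t)ᗮ ∧ ‖(f : H)‖ = 1 ∧
      ‖shift A t f‖ ≤ 1 / ((n : ℝ) + 1) := by
    intro n
    obtain ⟨f, hf, hlt⟩ := hcon (1 / ((n : ℝ) + 1)) (by positivity)
    have h0 : (f : H) ≠ 0 := by
      intro h
      rw [h, norm_zero, mul_zero] at hlt
      have : f = 0 := Subtype.ext h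
      rw [this, map_zero, norm_zero] at hlt
      exact lt_irrefl _ hlt
    have hn : 0 < ‖(f : H)‖ := norm_pos_iff.2 h0
    refine ⟨((‖(f : H)‖⁻¹ : ℝ) : ℂ) • f, Submodule.smul_mem _ _ hf, ?_, ?_⟩
    · rw [Submodule.coe_smul, norm_smul, Complex.norm_real, norm_inv, norm_norm,
        inv_mul_cancel₀ hn.ne']
    · rw [map_smul, norm_smul, Complex.norm_real, norm_inv, norm_norm, inv_mul_le_iff₀ hn]
      linarith
  choose f hf hf1 hfs using hseq
  have : ProperSpace K.range := FiniteDimensional.proper ℂ _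
  let k : ℕ → K.range := fun n => ⟨K (f n), ⟨f n, rfl⟩⟩
  obtain ⟨a, -, θ, hθ, hlim⟩ := tendsto_subseq_of_bounded (x := k)
    (Metric.isBounded_closedBall (x := (0 : K.range)) (r := ‖K‖)) fun n => by
      rw [mem_closedBall_zero_iff]
      simpa [hf1] using K.le_opNorm (f n)
  have hs0 : Tendsto (fun n => shift A t (f n)) atTop (𝓝 0) :=
    squeeze_zero_norm hfs tendsto_one_div_add_atTop_nhds_zero_nat
  have hs : Tendsto (fun n => shift A t (f (θ n))) atTop (𝓝 0) := hs0.comp hθ.tendsto_atTop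
  have hk : Tendsto (fun n => K (f (θ n))) atTop (𝓝 (a : H)) :=
    (continuous_subtype_val.tendsto a).comp hlim
  have hcs : CauchySeq (fun n => (f (θ n) : H)) := by
    have hu := (hs.add hk).cauchySeq
    rw [Metric.cauchySeq_iff] at hu ⊢
    intro ε hε
    obtain ⟨N, hN⟩ := hu (δ * ε) (by positivity)
    refine ⟨N, fun m hm n hn => ?_⟩
    have h1 := hN m hm n hn
    have h2 := norm_le_shift_add hδ ht (f (θ m) - f (θ n))
    rw [map_sub, Submodule.coe_sub, map_sub] at h2
    have e : shift A t (f (θ m)) - shift A t (f (θ n)) + (K (f (θ m)) - K (f (θ n)))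
      = (shift A t (f (θ m)) + K (f (θ m))) - (shift A t (f (θ n)) + K (f (θ n))) := by abel
    rw [e, ← dist_eq_norm, ← dist_eq_norm] at h2
    exact lt_of_mul_lt_mul_left (h2.trans_lt h1) hpos.le
  obtain ⟨x, hx, hx0⟩ := tendsto_of_shift_cauchy hA hcs hs
  have hxn : ‖(x : H)‖ = 1 := by
    refine tendsto_nhds_unique hx.norm ?_
    simp [hf1]
  have hxo : (x : H) ∈ (eigenspace A t)ᗮ :=
    (Submodule.isClosed_orthogonal _).mem_of_tendsto hx (Eventually.of_forall fun n => hf _)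
  have hxe : (x : H) ∈ eigenspace A t := mem_eigenspace_iff.2 ⟨x.2, sub_eq_zero.1 hx0⟩
  have : (x : H) = 0 := by
    have := (Submodule.mem_orthogonal _ _).1 hxo _ hxe
    exact inner_self_eq_zero.1 this
  rw [this, norm_zero] at hxn
  exact zero_ne_one hxn

lemma isResolventPoint_of_real_bound (hA : IsSelfAdjoint A) {t c : ℝ} (hc : 0 < c)
    (hb : ∀ f : A.domain, c * ‖(f : H)‖ ≤ ‖shift A t f‖) : IsResolventPoint A t := by
  refine isResolventPoint_of_bound hA hc hb fun f hf => ?_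
  rw [Complex.conj_ofReal] at hf
  have := hb f
  rw [shift_apply, hf, sub_self, norm_zero] at this
  have h0 : ‖(f : H)‖ = 0 := le_antisymm (by nlinarith [norm_nonneg (f : H)]) (norm_nonneg _)
  exact Subtype.ext (norm_eq_zero.1 h0)

lemma isResolventPoint_of_not_isEigenvalue (hA : IsSelfAdjoint A) [FiniteDimensional ℂ K.range]
    (hpos : 0 < δ)
    (hδ : ∀ f : A.domain, δ * ‖(f : H)‖ ^ 2 ≤ (inner ℂ (A f + K f) (f : H)).re)
    {t : ℝ} (ht : t ≤ 0) (he : ¬ IsEigenvalue A t) : IsResolventPoint A t := by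
  obtain ⟨c, hc, hb⟩ := exists_bound_on_orthogonal hA hpos hδ ht
  rw [IsEigenvalue, not_not] at he
  simp only [he, Submodule.bot_orthogonal_eq_top, Submodule.mem_top, forall_const] at hb
  exact isResolventPoint_of_real_bound hA hc hb

/-- An eigenvalue `t ≤ 0` belongs to the pure point spectrum. -/
lemma mem_pointSpectrum (hA : IsSelfAdjoint A) [FiniteDimensional ℂ K.range]
    (hpos : 0 < δ)
    (hδ : ∀ f : A.domain, δ * ‖(f : H)‖ ^ 2 ≤ (inner ℂ (A f + K f) (f : H)).re)
    {t : ℝ} (ht : t ≤ 0) (he : IsEigenvalue A t) : (t : ℂ) ∈ pointSpectrum A := by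
  have hfd := finiteDimensional_eigenspace hpos hδ ht
  refine ⟨he, hfd, ?_⟩
  obtain ⟨c, hc, hb⟩ := exists_bound_on_orthogonal hA hpos hδ ht
  -- For `|t - r| < c / 2` the lower bound `c - |t - r|` on the complement still exceeds `|t - r|`,
  -- which is the size of `A - r` on the eigenspace. By Pythagoras `A - r` is then bounded below by
  -- `|t - r|` on the whole domain.
  refine ⟨c / 2, by positivity, ?_⟩
  rintro z ⟨hz, hspec⟩
  by_contra hne
  refine hspec ?_
  by_cases him : z.im = 0
  swap
  · exact isResolventPoint_of_im_ne_zero hA him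
  obtain ⟨r, rfl⟩ : ∃ r : ℝ, z = r := ⟨z.re, Complex.ext rfl (by simp [him])⟩
  have hrt : 0 < |t - r| := abs_pos.2 fun h => hne (by
    rw [Set.mem_singleton_iff, sub_eq_zero.1 h])
  have hrc : |t - r| < c / 2 := by
    rw [Metric.mem_ball, dist_comm, dist_eq_norm, ← Complex.ofReal_sub, Complex.norm_real] at hz
    exact hz
  refine isResolventPoint_of_real_bound hA hrt fun f => ?_
  set p : H := (eigenspace A t).starProjection f with hp
  have hpm : p ∈ eigenspace A t := Submodule.starProjection_apply_mem _ _
  obtain ⟨hpd, hpe⟩ := mem_eigenspace_iff.1 hpm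
  have hgo : (f : H) - p ∈ (eigenspace A t)ᗮ := Submodule.sub_starProjection_mem_orthogonal _
  set g : A.domain := f - ⟨p, hpd⟩ with hg
  have hgv : (g : H) = f - p := rfl
  have hfv : (f : H) = p + g := by rw [hgv]; abel
  have hf : f = ⟨p, hpd⟩ + g := by rw [hg]; abel
  have hpg : inner ℂ p (g : H) = 0 := (Submodule.mem_orthogonal _ _).1 hgo _ hpm
  have hpA : inner ℂ p (A g) = 0 := by
    rw [← inner_apply_left hA ⟨p, hpd⟩ g, hpe, inner_smul_left, hpg, mul_zero]
  -- The splitting into eigenspace and complement is preserved by `A - r`, so the images of `p` and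
  -- `g` are orthogonal too.
  have hsg : inner ℂ p (shift A r g) = 0 := by
    rw [shift_apply, inner_sub_right, inner_smul_right, hpA, hpg]; simp
  have hsp : shift A r ⟨p, hpd⟩ = ((t - r : ℝ) : ℂ) • p := by
    rw [shift_apply, hpe, ← sub_smul]; push_cast; rfl
  have hbg : |t - r| * ‖(g : H)‖ ≤ ‖shift A r g‖ := by
    have h1 := hb g hgo
    have h2 : shift A t g = shift A r g - ((t - r : ℝ) : ℂ) • (g : H) := by
      rw [shift_apply, shift_apply]; push_cast; rw [sub_smul]; abel
    have h3 : ‖shift A t g‖ ≤ ‖shift A r g‖ + |t - r| * ‖(g : H)‖ := by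
      rw [h2]
      refine (norm_sub_le _ _).trans_eq ?_
      rw [norm_smul, Complex.norm_real, Real.norm_eq_abs]
    nlinarith [norm_nonneg (g : H)]
  have e1 : ‖(f : H)‖ * ‖(f : H)‖ = ‖p‖ * ‖p‖ + ‖(g : H)‖ * ‖(g : H)‖ := by
    rw [hfv]; exact norm_add_sq_eq_norm_sq_add_norm_sq_of_inner_eq_zero _ _ hpg
  have e2 : ‖shift A r f‖ * ‖shift A r f‖ = (|t - r| * ‖p‖) * (|t - r| * ‖p‖)
      + ‖shift A r g‖ * ‖shift A r g‖ := by
    conv_lhs => rw [hf]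
    rw [map_add, hsp, norm_add_sq_eq_norm_sq_add_norm_sq_of_inner_eq_zero _ _
      (by rw [inner_smul_left, hsg, mul_zero]), norm_smul, Complex.norm_real, Real.norm_eq_abs]
  refine le_of_sq_le_sq ?_ (norm_nonneg _)
  have h3 := mul_self_le_mul_self (by positivity) hbg
  calc (|t - r| * ‖(f : H)‖) ^ 2 = |t - r| ^ 2 * (‖(f : H)‖ * ‖(f : H)‖) := by ring
    _ ≤ ‖shift A r f‖ * ‖shift A r f‖ := by rw [e1, e2]; linarith
    _ = _ := (sq _).symm

/-- Nonreal points are resolvent points; a real `t ≤ 0` is either an eigenvalue, hence in the pure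
point spectrum, or a resolvent point. -/
theorem essentialSpectrum_subset (hA : IsSelfAdjoint A) [FiniteDimensional ℂ K.range]
    (hpos : 0 < δ)
    (hδ : ∀ f : A.domain, δ * ‖(f : H)‖ ^ 2 ≤ (inner ℂ (A f + K f) (f : H)).re) :
    essentialSpectrum A ⊆ (fun t : ℝ => (t : ℂ)) '' Set.Ioi 0 := by
  rintro z ⟨hz, hp⟩
  by_cases him : z.im = 0
  swap
  · exact absurd (isResolventPoint_of_im_ne_zero hA him) hz
  obtain ⟨r, rfl⟩ : ∃ r : ℝ, z = r := ⟨z.re, Complex.ext rfl (by simp [him])⟩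
  refine ⟨r, ?_, rfl⟩
  by_contra hr
  have hr : r ≤ 0 := not_lt.1 hr
  by_cases he : IsEigenvalue A r
  · exact hp (mem_pointSpectrum hA hpos hδ hr he)
  · exact hz (isResolventPoint_of_not_isEigenvalue hA hpos hδ hr he)

/-- If `A - t ≥ 0` is boundedly invertible, then it is bounded below as a quadratic form. -/
lemma exists_form_bound_of_isResolventPoint (hA : IsSelfAdjoint A) {t : ℝ}
    (hR : IsResolventPoint A t)
    (hnn : ∀ f : A.domain, t * ‖(f : H)‖ ^ 2 ≤ (inner ℂ (A f) (f : H)).re) :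
    ∃ c > 0, ∀ f : A.domain, (t + c) * ‖(f : H)‖ ^ 2 ≤ (inner ℂ (A f) (f : H)).re := by
  obtain ⟨R, hR, -⟩ := hR
  -- The summand `1` only keeps `C` positive when `R = 0`.
  set C : ℝ := ‖R‖ + 1 with hC
  have hC0 : 0 < C := by positivity
  refine ⟨C⁻¹, by positivity, fun f => ?_⟩
  obtain ⟨hd, he⟩ := hR f
  set g : A.domain := ⟨R f, hd⟩ with hg
  have hsg : shift A t g = f := he
  -- Nonnegativity is tested at `f - C⁻¹ (A - t)⁻¹ f`: the cross terms contribute `-2 C⁻¹ ‖f‖²` and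
  -- the quadratic term at most `C⁻¹ ‖f‖²`, which leaves a gain of `C⁻¹`.
  have h0 := hnn (f - ((C⁻¹ : ℝ) : ℂ) • g)
  rw [← sub_nonneg, ← re_inner_shift] at h0
  have hfg : inner ℂ (shift A t f) (g : H) = inner ℂ (f : H) (f : H) := by
    have h1 : inner ℂ (shift A t g) (f : H) = inner ℂ (g : H) (shift A t f) := by
      rw [shift_apply, shift_apply, inner_sub_left, inner_sub_right, inner_smul_left,
        inner_smul_right, inner_apply_left hA, Complex.conj_ofReal]
    have h2 : inner ℂ (f : H) (f : H) = inner ℂ (g : H) (shift A t f) := by rw [← h1, hsg]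
    rw [← inner_conj_symm, ← h2, inner_conj_symm]
  have hbd : (inner ℂ (f : H) (g : H)).re ≤ C * ‖(f : H)‖ ^ 2 := by
    refine (Complex.re_le_norm _).trans ((norm_inner_le_norm _ _).trans ?_)
    have : ‖(g : H)‖ ≤ ‖R‖ * ‖(f : H)‖ := R.le_opNorm _
    nlinarith [norm_nonneg (f : H)]
  have e : (inner ℂ (shift A t (f - ((C⁻¹ : ℝ) : ℂ) • g))
      ((f - ((C⁻¹ : ℝ) : ℂ) • g : A.domain) : H)).re
      = ((inner ℂ (A f) (f : H)).re - t * ‖(f : H)‖ ^ 2) - 2 * C⁻¹ * ‖(f : H)‖ ^ 2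
        + C⁻¹ ^ 2 * (inner ℂ (f : H) (g : H)).re := by
    rw [map_sub, map_smul, hsg, Submodule.coe_sub, Submodule.coe_smul, inner_sub_left,
      inner_sub_right, inner_sub_right, inner_smul_left, inner_smul_right, inner_smul_left,
      inner_smul_right, hfg, Complex.conj_ofReal, inner_self_eq_norm_sq_to_K]
    have : ((‖(f : H)‖ : ℂ) ^ 2) = ((‖(f : H)‖ ^ 2 : ℝ) : ℂ) := by push_cast; rfl
    simp only [Complex.coe_algebraMap, this, Complex.sub_re, Complex.re_ofReal_mul, re_inner_shift,
      Complex.ofReal_re]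
    ring
  rw [e] at h0
  have h1 : C⁻¹ ^ 2 * (inner ℂ (f : H) (g : H)).re ≤ C⁻¹ * ‖(f : H)‖ ^ 2 := by
    calc _ ≤ C⁻¹ ^ 2 * (C * ‖(f : H)‖ ^ 2) := by gcongr
      _ = _ := by field_simp
  linarith

/-- If the quadratic form of `A` takes a negative value, then `A` has a negative eigenvalue. -/
theorem exists_neg_eigenvalue (hA : IsSelfAdjoint A) [FiniteDimensional ℂ K.range]
    (hpos : 0 < δ)
    (hδ : ∀ f : A.domain, δ * ‖(f : H)‖ ^ 2 ≤ (inner ℂ (A f + K f) (f : H)).re)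
    {f₀ : A.domain} (hf₀ : (inner ℂ (A f₀) (f₀ : H)).re < 0) :
    ∃ t : ℝ, t < 0 ∧ IsEigenvalue A t := by
  set S : Set ℝ := {r | ∃ f : A.domain, f ≠ 0 ∧
    r = (inner ℂ (A f) (f : H)).re / ‖(f : H)‖ ^ 2} with hS
  have hn : ∀ f : A.domain, f ≠ 0 → 0 < ‖(f : H)‖ ^ 2 := fun f hf => by
    have : (f : H) ≠ 0 := fun h => hf (Subtype.ext h)
    positivity
  have hf₀0 : f₀ ≠ 0 := by rintro rfl; simp at hf₀
  have hmem : (inner ℂ (A f₀) (f₀ : H)).re / ‖(f₀ : H)‖ ^ 2 ∈ S := ⟨f₀, hf₀0, rfl⟩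
  have hbdd : BddBelow S := by
    refine ⟨δ - ‖K‖, ?_⟩
    rintro _ ⟨f, hf, rfl⟩
    rw [le_div_iff₀ (hn f hf)]
    have h1 := hδ f
    rw [inner_add_left, Complex.add_re] at h1
    have h2 : (inner ℂ (K f) (f : H)).re ≤ ‖K‖ * ‖(f : H)‖ ^ 2 := by
      refine (Complex.re_le_norm _).trans ((norm_inner_le_norm _ _).trans ?_)
      nlinarith [K.le_opNorm f, norm_nonneg (f : H)]
    linarith
  -- The candidate is the infimum of the Rayleigh quotient. Were it not an eigenvalue, it would be a
  -- resolvent point, and the form bound `t + c` would contradict minimality.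
  set t := sInf S with ht
  have ht0 : t < 0 := (csInf_le hbdd hmem).trans_lt (div_neg_of_neg_of_pos hf₀ (hn _ hf₀0))
  refine ⟨t, ht0, ?_⟩
  by_contra he
  obtain ⟨c, hc, hb⟩ := exists_form_bound_of_isResolventPoint hA
    (isResolventPoint_of_not_isEigenvalue hA hpos hδ ht0.le he) fun f => by
      by_cases hf : f = 0
      · simp [hf]
      · exact (le_div_iff₀ (hn f hf)).1 (csInf_le hbdd ⟨f, hf, rfl⟩)
  have : t + c ≤ t := by
    refine le_csInf ⟨_, hmem⟩ ?_
    rintro _ ⟨f, hf, rfl⟩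
    exact (le_div_iff₀ (hn f hf)).2 (hb f)
  linarith

/-- On the span of two eigenvectors with distinct eigenvalues, the quadratic form is diagonal. -/
lemma re_inner_combination (hA : IsSelfAdjoint A) {s t : ℝ} {f g : A.domain}
    (hf : A f = (s : ℂ) • (f : H)) (hg : A g = (t : ℂ) • (g : H)) (hst : s ≠ t) (a b : ℂ) :
    (inner ℂ (A (a • f + b • g)) ((a • f + b • g : A.domain) : H)).re
      = s * ‖a • (f : H)‖ ^ 2 + t * ‖b • (g : H)‖ ^ 2 := by
  have horth : inner ℂ (f : H) (g : H) = 0 := by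
    have h := inner_apply_left hA f g
    rw [hf, hg, inner_smul_left, inner_smul_right, Complex.conj_ofReal, ← sub_eq_zero,
      ← sub_mul, mul_eq_zero] at h
    refine h.resolve_left fun h0 => hst ?_
    exact_mod_cast sub_eq_zero.1 h0
  have horth' : inner ℂ (g : H) (f : H) = 0 := inner_eq_zero_symm.1 horth
  have h1 : A (a • f + b • g) = (s : ℂ) • (a • (f : H)) + (t : ℂ) • (b • (g : H)) := by
    rw [A.map_add, A.map_smul, A.map_smul, hf, hg, smul_comm a, smul_comm b]
  rw [h1, Submodule.coe_add, Submodule.coe_smul, Submodule.coe_smul, inner_add_left,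
    inner_add_right, inner_add_right]
  have e1 : ∀ x : H, (inner ℂ x x) = ((‖x‖ ^ 2 : ℝ) : ℂ) := fun x => by
    rw [inner_self_eq_norm_sq_to_K]; push_cast; rfl
  rw [inner_smul_left (a • (f : H)), inner_smul_left (b • (g : H)),
    inner_smul_left (b • (g : H)), inner_smul_left (a • (f : H)) (b • (g : H)), e1, e1]
  simp only [inner_smul_left, inner_smul_right, horth, horth', Complex.conj_ofReal,
    mul_zero, add_zero, zero_add, ← Complex.ofReal_mul, ← Complex.ofReal_add, Complex.ofReal_re]

/-- If every pair of vectors has a nontrivial combination on which the form is nonnegative, then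
there is at most one negative eigenvalue, and it is simple. -/
theorem morseIndex_eq_one (hA : IsSelfAdjoint A)
    (hpair : ∀ f g : A.domain, ∃ a b : ℂ, (a ≠ 0 ∨ b ≠ 0) ∧
      0 ≤ (inner ℂ (A (a • f + b • g)) ((a • f + b • g : A.domain) : H)).re)
    {t : ℝ} (ht : t < 0) (het : IsEigenvalue A t) : morseIndex A = 1 := by
  -- Eigenvectors for two distinct negative eigenvalues span a plane on which the form is negative
  -- definite, against `hpair`.
  have hother : ∀ s : ℝ, s < 0 → s ≠ t → eigenspace A s = ⊥ := by
    intro s hs hst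
    by_contra he
    obtain ⟨f, hf0, hf⟩ := isEigenvalue_iff.1 he
    obtain ⟨g, hg0, hg⟩ := isEigenvalue_iff.1 het
    obtain ⟨a, b, hab, h⟩ := hpair f g
    rw [re_inner_combination hA hf hg hst] at h
    have hf0' : (f : H) ≠ 0 := fun h => hf0 (Subtype.ext h)
    have hg0' : (g : H) ≠ 0 := fun h => hg0 (Subtype.ext h)
    rcases hab with ha | hb
    · have : 0 < ‖a • (f : H)‖ ^ 2 := by
        have := smul_ne_zero ha hf0'
        positivity
      nlinarith [sq_nonneg ‖b • (g : H)‖]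
    · have : 0 < ‖b • (g : H)‖ ^ 2 := by
        have := smul_ne_zero hb hg0'
        positivity
      nlinarith [sq_nonneg ‖a • (f : H)‖]
  -- Within one eigenspace the form is `t ‖·‖²`, so the combination given by `hpair` must vanish:
  -- any two eigenvectors are dependent.
  have hone : Module.rank ℂ (eigenspace A t) = 1 := by
    obtain ⟨g, hg0, hg⟩ := isEigenvalue_iff.1 het
    rw [rank_eq_one_iff]
    refine ⟨⟨g, mem_eigenspace_iff.2 ⟨g.2, hg⟩⟩, fun h => hg0 (by
      simpa using h), ?_⟩
    rintro ⟨f, hf⟩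
    obtain ⟨hfd, hf⟩ := mem_eigenspace_iff.1 hf
    obtain ⟨a, b, hab, h⟩ := hpair ⟨f, hfd⟩ g
    rw [re_inner_eigenvector (s := t) (by
      rw [A.map_add, A.map_smul, A.map_smul, hf, hg, Submodule.coe_add, Submodule.coe_smul,
        Submodule.coe_smul, smul_add, smul_comm a, smul_comm b])] at h
    have h0 : a • f + b • (g : H) = 0 := by
      by_contra hne
      have : 0 < ‖((a • ⟨f, hfd⟩ + b • g : A.domain) : H)‖ ^ 2 := by
        have : ((a • ⟨f, hfd⟩ + b • g : A.domain) : H) ≠ 0 := hne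
        positivity
      nlinarith
    have ha : a ≠ 0 := by
      rintro rfl
      rw [zero_smul, zero_add, smul_eq_zero] at h0
      rcases h0 with h0 | h0
      · simp [h0] at hab
      · exact hg0 (Subtype.ext h0)
    refine ⟨-(a⁻¹ * b), Subtype.ext ?_⟩
    change -(a⁻¹ * b) • (g : H) = f
    have h1 : b • (g : H) = -(a • f) := eq_neg_of_add_eq_zero_right h0
    rw [neg_smul, mul_smul, h1, smul_neg, neg_neg, smul_smul, inv_mul_cancel₀ ha, one_smul]
  rw [morseIndex, tsum_eq_single (⟨t, ht⟩ : Set.Iio (0 : ℝ))]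
  · simp [hone]
  · rintro ⟨s, hs⟩ hne
    have := hother s hs fun h => hne (Subtype.ext h)
    simp [this]

/-- If every pair of vectors has a nontrivial combination which vanishes or on which the form is
positive, then `0` and a negative number cannot both be eigenvalues. -/
theorem not_isEigenvalue_zero (hA : IsSelfAdjoint A)
    (hpair : ∀ f g : A.domain, ∃ a b : ℂ, (a ≠ 0 ∨ b ≠ 0) ∧ (a • f + b • g ≠ 0 →
      0 < (inner ℂ (A (a • f + b • g)) ((a • f + b • g : A.domain) : H)).re))
    {t : ℝ} (ht : t < 0) (het : IsEigenvalue A t) : ¬ IsEigenvalue A 0 := by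
  intro he
  obtain ⟨f, hf0, hf⟩ := isEigenvalue_iff.1 he
  obtain ⟨g, hg0, hg⟩ := isEigenvalue_iff.1 het
  obtain ⟨a, b, hab, h⟩ := hpair f g
  have hf0' : (f : H) ≠ 0 := fun h => hf0 (Subtype.ext h)
  have hg0' : (g : H) ≠ 0 := fun h => hg0 (Subtype.ext h)
  have hf : A f = ((0 : ℝ) : ℂ) • (f : H) := by simpa using hf
  rw [re_inner_combination hA hf hg ht.ne'] at h
  -- The combination cannot vanish, since eigenvectors for distinct eigenvalues are independent; if
  -- it does not vanish, its form is `t ‖b • g‖² ≤ 0`, against `h`.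
  by_cases h0 : a • f + b • g = 0
  · have h1 := re_inner_combination hA hf hg ht.ne' a b
    rw [h0] at h1
    simp only [ZeroMemClass.coe_zero, inner_zero_right, Complex.zero_re, zero_mul, zero_add] at h1
    have hb : b = 0 := by
      by_contra hb
      have := smul_ne_zero hb hg0'
      have : 0 < ‖b • (g : H)‖ ^ 2 := by positivity
      nlinarith
    rw [hb, zero_smul, add_zero, smul_eq_zero] at h0
    rcases h0 with h0 | h0
    · simp [h0, hb] at hab
    · exact hf0 h0
  · have := h h0
    nlinarith [sq_nonneg ‖b • (g : H)‖]

end Abstract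

/-! ### The Sobolev space `H²(ℝ)` -/

section Sobolev

open Filter Topology TemperedDistribution

/-- In the Fourier normalisation with kernel `exp (-2πixξ)`, the operator `∂ₓₓ` has symbol `-(2π)²
ξ²`, while the Bessel potential of order `2` has symbol `1 + ξ²`. -/
lemma besselPotential_two (f : 𝓢'(ℝ, ℂ)) :
    besselPotential ℝ ℂ 2 f = f - (((2 * π) ^ 2)⁻¹ : ℂ) • ∂_{(1 : ℝ)} (∂_{(1 : ℝ)} f) := by
  have hpi : (2 * (π : ℂ)) ≠ 0 := by
    have := Real.pi_ne_zero
    exact mul_ne_zero two_ne_zero (by exact_mod_cast this)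
  have h1 : ∂_{(1 : ℝ)} (∂_{(1 : ℝ)} f)
      = (-((2 * π) ^ 2) : ℂ) • fourierMultiplierCLM ℂ (fun x : ℝ => ((‖x‖ ^ 2 : ℝ) : ℂ)) f := by
    rw [lineDeriv_eq_fourierMultiplierCLM, lineDeriv_eq_fourierMultiplierCLM, map_smul,
      fourierMultiplierCLM_fourierMultiplierCLM_apply (by fun_prop) (by fun_prop), smul_smul]
    congr 1
    · rw [mul_mul_mul_comm, Complex.I_mul_I]; ring
    · congr 1
      congr 1
      ext x
      simp [sq]
  have h2 : besselPotential ℝ ℂ 2 f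
      = f + fourierMultiplierCLM ℂ (fun x : ℝ => ((‖x‖ ^ 2 : ℝ) : ℂ)) f := by
    have := congrArg (fun T : 𝓢'(ℝ, ℂ) →L[ℂ] 𝓢'(ℝ, ℂ) => T f)
      (fourierMultiplierCLM_sum (F := ℂ) (s := Finset.univ)
        (g := fun (i : Bool) (x : ℝ) => if i then (1 : ℂ) else ((‖x‖ ^ 2 : ℝ) : ℂ)) (by
          rintro (_ | _) -
          · simp only [Bool.false_eq_true, if_false]; fun_prop
          · simp only [if_true]; fun_prop))
    simp only [Fintype.sum_bool, if_true, Bool.false_eq_true, if_false] at this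
    rw [besselPotential]
    have e : (fun x : ℝ => (((1 + ‖x‖ ^ 2) ^ ((2 : ℝ) / 2) : ℝ) : ℂ))
        = fun x : ℝ => 1 + ((‖x‖ ^ 2 : ℝ) : ℂ) := by
      ext x; simp
    rw [e, this]
    simp
  rw [h2, h1, smul_smul, mul_neg, inv_mul_cancel₀ (pow_ne_zero 2 hpi), neg_one_smul, sub_neg_eq_add]

lemma mem_H2_iff {f : L2} : f ∈ H2 ↔ MemSobolev 2 2 (f : 𝓢'(ℝ, ℂ)) := Iff.rfl

lemma secondDeriv_eq {f : H2} {g : L2}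
    (h : (g : 𝓢'(ℝ, ℂ)) = ∂_{(1 : ℝ)} (∂_{(1 : ℝ)} ((f : L2) : 𝓢'(ℝ, ℂ)))) : secondDeriv f = g := by
  apply toTemperedDistribution_injective
  simp only [Lp.toTemperedDistributionCLM_apply]
  rw [secondDeriv_spec, h]

/-- A function in `L²` whose second distributional derivative is in `L²` belongs to `H²`. -/
lemma mem_H2_of_secondDeriv {f g : L2}
    (h : (g : 𝓢'(ℝ, ℂ)) = ∂_{(1 : ℝ)} (∂_{(1 : ℝ)} (f : 𝓢'(ℝ, ℂ)))) :
    ∃ hf : f ∈ H2, secondDeriv ⟨f, hf⟩ = g := by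
  have hf : f ∈ H2 := by
    -- Membership in `H²` asks for an `L²` representative of the Bessel potential of order `2`,
    -- which `besselPotential_two` computes.
    refine ⟨f - (((2 * π) ^ 2)⁻¹ : ℂ) • g, ?_⟩
    rw [besselPotential_two, ← h]
    simp only [← Lp.toTemperedDistributionCLM_apply, map_sub, map_smul]
  exact ⟨hf, secondDeriv_eq h⟩

lemma exists_besselInverse (g : L2) :
    ∃ f : L2, (f : 𝓢'(ℝ, ℂ)) = besselPotential ℝ ℂ (-2) (g : 𝓢'(ℝ, ℂ)) := by
  have h : MemSobolev 2 2 (besselPotential ℝ ℂ (-2) (g : 𝓢'(ℝ, ℂ))) := by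
    rw [memSobolev_besselPotential_iff, neg_add_cancel, memSobolev_zero_iff]; exact ⟨g, rfl⟩
  obtain ⟨f, hf⟩ := memSobolev_zero_iff.1 (h.mono (by norm_num : (0 : ℝ) ≤ 2))
  exact ⟨f, hf.symm⟩

/-- The inverse of `1 - (2π)⁻² ∂ₓₓ` on `L²(ℝ)`, as a linear map. -/
def besselInverseLinear : L2 →ₗ[ℂ] L2 where
  toFun g := (exists_besselInverse g).choose
  map_add' f g := by
    apply toTemperedDistribution_injective
    rw [map_add]
    simp only [Lp.toTemperedDistributionCLM_apply]
    rw [(exists_besselInverse (f + g)).choose_spec, (exists_besselInverse f).choose_spec,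
      (exists_besselInverse g).choose_spec, ← Lp.toTemperedDistributionCLM_apply, map_add, map_add]
    rfl
  map_smul' c f := by
    apply toTemperedDistribution_injective
    rw [map_smul]
    simp only [Lp.toTemperedDistributionCLM_apply, RingHom.id_apply]
    rw [(exists_besselInverse (c • f)).choose_spec, (exists_besselInverse f).choose_spec,
      ← Lp.toTemperedDistributionCLM_apply, map_smul, map_smul]
    rfl

/-- Closed graph theorem: limits are identified among tempered distributions, where the Bessel
potential is continuous. -/
lemma continuous_besselInverseLinear : Continuous besselInverseLinear := by
  refine LinearMap.continuous_of_seq_closed_graph _ fun u x y hu hy => ?_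
  apply toTemperedDistribution_injective
  have h1 := ((Lp.toTemperedDistributionCLM ℂ (volume : Measure ℝ) 2).continuous.tendsto y).comp hy
  have h2 := (((besselPotential ℝ ℂ (-2)).comp
    (Lp.toTemperedDistributionCLM ℂ (volume : Measure ℝ) 2)).continuous.tendsto x).comp hu
  have e : (Lp.toTemperedDistributionCLM ℂ (volume : Measure ℝ) 2 (besselInverseLinear x))
      = besselPotential ℝ ℂ (-2) (x : 𝓢'(ℝ, ℂ)) := (exists_besselInverse x).choose_spec
  refine (tendsto_nhds_unique h1 (h2.congr fun n => ?_)).trans e.symm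
  exact (exists_besselInverse (u n)).choose_spec.symm

/-- The inverse of `1 - (2π)⁻² ∂ₓₓ` on `L²(ℝ)`. -/
def besselInverse : L2 →L[ℂ] L2 := ⟨besselInverseLinear, continuous_besselInverseLinear⟩

lemma besselInverse_spec (g : L2) :
    ((besselInverse g : L2) : 𝓢'(ℝ, ℂ)) = besselPotential ℝ ℂ (-2) (g : 𝓢'(ℝ, ℂ)) :=
  (exists_besselInverse g).choose_spec

lemma eq_besselInverse {f g : L2}
    (h : besselPotential ℝ ℂ 2 (f : 𝓢'(ℝ, ℂ)) = (g : 𝓢'(ℝ, ℂ))) : f = besselInverse g := by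
  apply toTemperedDistribution_injective
  simp only [Lp.toTemperedDistributionCLM_apply]
  rw [besselInverse_spec, ← h, besselPotential_besselPotential_apply]
  simp

/-- The constant `(2π)⁻²`. -/
def invFourPiSq : ℂ := ((2 * π) ^ 2)⁻¹

lemma invFourPiSq_ne_zero : invFourPiSq ≠ 0 :=
  inv_ne_zero (pow_ne_zero 2 (mul_ne_zero two_ne_zero (by exact_mod_cast Real.pi_ne_zero)))

lemma conj_invFourPiSq : (starRingEnd ℂ) invFourPiSq = invFourPiSq := by
  have : invFourPiSq = ((((2 * π) ^ 2)⁻¹ : ℝ) : ℂ) := by rw [invFourPiSq]; push_cast; rfl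
  rw [this, Complex.conj_ofReal]

lemma besselInverse_sub_secondDeriv (f : H2) :
    besselInverse ((f : L2) - invFourPiSq • secondDeriv f) = f := by
  refine (eq_besselInverse ?_).symm
  rw [besselPotential_two, ← secondDeriv_spec]
  simp only [← Lp.toTemperedDistributionCLM_apply, map_sub, map_smul]
  rfl

lemma besselInverse_mem_H2 (g : L2) : besselInverse g ∈ H2 := by
  refine ⟨g, ?_⟩
  rw [besselInverse_spec, besselPotential_besselPotential_apply]
  simp

lemma sub_secondDeriv_besselInverse (g : L2) :
    besselInverse g - invFourPiSq • secondDeriv ⟨besselInverse g, besselInverse_mem_H2 g⟩ = g := by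
  apply toTemperedDistribution_injective
  rw [map_sub, map_smul]
  simp only [Lp.toTemperedDistributionCLM_apply]
  rw [secondDeriv_spec]
  have := besselPotential_two ((besselInverse g : L2) : 𝓢'(ℝ, ℂ))
  rw [besselInverse_spec, besselPotential_besselPotential_apply] at this
  rw [besselInverse_spec]
  simpa [invFourPiSq] using this.symm

/-! ### Schwartz functions in `H²(ℝ)` -/

lemma toLp_mem_H2 (φ : 𝓢(ℝ, ℂ)) : (φ.toLp 2 volume : L2) ∈ H2 := by
  rw [mem_H2_iff, Lp.toTemperedDistribution_toLp_eq]
  exact SchwartzMap.memSobolev φ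

lemma secondDeriv_toLp (φ : 𝓢(ℝ, ℂ)) :
    secondDeriv ⟨φ.toLp 2 volume, toLp_mem_H2 φ⟩
      = (∂_{(1 : ℝ)} (∂_{(1 : ℝ)} φ)).toLp 2 volume := by
  refine secondDeriv_eq ?_
  simp only [Lp.toTemperedDistribution_toLp_eq, lineDerivOp_toTemperedDistributionCLM_eq]

/-- Schwartz functions are dense in `H²` for the graph norm of the second derivative. -/
theorem exists_schwartz_tendsto (f : H2) : ∃ φ : ℕ → 𝓢(ℝ, ℂ),
    Tendsto (fun n => (φ n).toLp 2) atTop (𝓝 (f : L2)) ∧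
    Tendsto (fun n => (∂_{(1 : ℝ)} (∂_{(1 : ℝ)} (φ n))).toLp 2) atTop (𝓝 (secondDeriv f)) := by
  -- `besselInverse` sends `g` to `f`, so approximating `g` in `L²` controls `f`, and also `f''`, a
  -- multiple of `f - g`.
  set g : L2 := (f : L2) - invFourPiSq • secondDeriv f with hg
  have hd : DenseRange (SchwartzMap.toLpCLM ℝ ℂ 2 (volume : Measure ℝ)) :=
    SchwartzMap.denseRange_toLpCLM (by simp)
  obtain ⟨u, hu, hlim⟩ := mem_closure_iff_seq_limit.1 (hd g)
  choose ψ hψ using hu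
  have hψlim : Tendsto (fun n => (ψ n).toLp 2) atTop (𝓝 g) := by
    refine hlim.congr fun n => ?_
    rw [← hψ n, SchwartzMap.toLpCLM_apply]
  have hφ : ∀ n, ∃ φ : 𝓢(ℝ, ℂ), φ.toLp 2 = besselInverse ((ψ n).toLp 2) := by
    intro n
    -- The symbol `(1 + ξ²)⁻¹` is smooth of tempered growth, so its multiplier preserves Schwartz
    -- functions.
    refine ⟨SchwartzMap.fourierMultiplierCLM ℂ
      (fun x : ℝ ↦ (((1 + ‖x‖ ^ 2) ^ ((-2 : ℝ) / 2) : ℝ) : ℂ)) (ψ n), ?_⟩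
    apply toTemperedDistribution_injective
    simp only [Lp.toTemperedDistributionCLM_apply]
    rw [besselInverse_spec, besselPotential, Lp.toTemperedDistribution_toLp_eq,
      Lp.toTemperedDistribution_toLp_eq,
      fourierMultiplierCLM_toTemperedDistributionCLM_eq (by fun_prop)]
  choose φ hφ using hφ
  have h1 : Tendsto (fun n => (φ n).toLp 2) atTop (𝓝 (f : L2)) := by
    simp_rw [hφ]
    rw [← besselInverse_sub_secondDeriv f]
    exact (besselInverse.continuous.tendsto g).comp hψlim
  refine ⟨φ, h1, ?_⟩
  have h2 := (h1.sub hψlim).const_smul (invFourPiSq⁻¹)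
  have e1 : invFourPiSq⁻¹ • ((f : L2) - g) = secondDeriv f := by
    rw [hg, sub_sub_cancel, smul_smul, inv_mul_cancel₀ invFourPiSq_ne_zero, one_smul]
  rw [e1] at h2
  refine h2.congr fun n => ?_
  have e2 := sub_secondDeriv_besselInverse ((ψ n).toLp 2)
  have e3 : secondDeriv ⟨besselInverse ((ψ n).toLp 2), besselInverse_mem_H2 _⟩
      = (∂_{(1 : ℝ)} (∂_{(1 : ℝ)} (φ n))).toLp 2 := by
    rw [← secondDeriv_toLp]
    congr 1
    exact Subtype.ext (hφ n).symm
  rw [e3] at e2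
  have e4 : besselInverse ((ψ n).toLp 2 volume) - (ψ n).toLp 2 volume
      = invFourPiSq • (∂_{(1 : ℝ)} (∂_{(1 : ℝ)} (φ n))).toLp 2 volume := by
    rw [sub_eq_iff_eq_add', ← sub_eq_iff_eq_add, e2]
  rw [hφ, e4, smul_smul, inv_mul_cancel₀ invFourPiSq_ne_zero, one_smul]

/-! ### Classical `C²` functions -/

lemma integrable_mul_of_memLp {f g : ℝ → ℂ} (hf : MemLp f 2 volume) (hg : MemLp g 2 volume) :
    Integrable (fun x => f x * g x) := hf.integrable_mul hg

lemma schwartz_lineDeriv_apply (φ : 𝓢(ℝ, ℂ)) (x : ℝ) : ∂_{(1 : ℝ)} φ x = deriv φ x := by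
  rw [SchwartzMap.lineDerivOp_apply_eq_fderiv, fderiv_apply_one_eq_deriv]

lemma schwartz_hasDerivAt (φ : 𝓢(ℝ, ℂ)) (x : ℝ) : HasDerivAt φ (∂_{(1 : ℝ)} φ x) x := by
  rw [schwartz_lineDeriv_apply]
  exact φ.hasDerivAt x

/-- A twice differentiable function which is in `L²` with its derivatives belongs to `H²`. -/
theorem toLp_mem_H2_of_hasDerivAt {f f' f'' : ℝ → ℂ} (h1 : ∀ x, HasDerivAt f (f' x) x)
    (h2 : ∀ x, HasDerivAt f' (f'' x) x) (m0 : MemLp f 2 volume) (m1 : MemLp f' 2 volume)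
    (m2 : MemLp f'' 2 volume) :
    ∃ hf : m0.toLp f ∈ H2, secondDeriv ⟨m0.toLp f, hf⟩ = m2.toLp f'' := by
  refine mem_H2_of_secondDeriv ?_
  ext g
  have mg : ∀ φ : 𝓢(ℝ, ℂ), MemLp φ 2 volume := fun φ => φ.memLp 2
  have e1 : ∫ x, g x * f'' x = -∫ x, ∂_{(1 : ℝ)} g x * f' x :=
    integral_mul_deriv_eq_deriv_mul_of_integrable (fun x _ => schwartz_hasDerivAt g x)
      (fun x _ => h2 x) (integrable_mul_of_memLp (mg _) m2) (integrable_mul_of_memLp (mg _) m1)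
      (integrable_mul_of_memLp (mg _) m1)
  have e2 : ∫ x, ∂_{(1 : ℝ)} g x * f' x = -∫ x, ∂_{(1 : ℝ)} (∂_{(1 : ℝ)} g) x * f x :=
    integral_mul_deriv_eq_deriv_mul_of_integrable (fun x _ => schwartz_hasDerivAt _ x)
      (fun x _ => h1 x) (integrable_mul_of_memLp (mg _) m1) (integrable_mul_of_memLp (mg _) m0)
      (integrable_mul_of_memLp (mg _) m0)
  rw [lineDerivOp_apply_apply, lineDerivOp_apply_apply, LineDeriv.lineDerivOp_neg, neg_neg,
    Lp.toTemperedDistribution_apply, Lp.toTemperedDistribution_apply]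
  have c0 : ∫ x, g x • (m2.toLp f'') x = ∫ x, g x * f'' x :=
    integral_congr_ae (by filter_upwards [m2.coeFn_toLp] with x hx; rw [hx, smul_eq_mul])
  have c1 : ∫ x, ∂_{(1 : ℝ)} (∂_{(1 : ℝ)} g) x • (m0.toLp f) x
      = ∫ x, ∂_{(1 : ℝ)} (∂_{(1 : ℝ)} g) x * f x :=
    integral_congr_ae (by filter_upwards [m0.coeFn_toLp] with x hx; rw [hx, smul_eq_mul])
  rw [c0, c1, e1, e2, neg_neg]

end Sobolev

/-! ### Schrödinger operators with bounded continuous potential -/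

section Schrodinger

open Filter Topology

/-- The potential `V` is continuous and bounded. -/
structure IsBddPotential (V : ℝ → ℝ) : Prop where
  continuous : Continuous V
  bounded : ∃ C, ∀ x, |V x| ≤ C

variable {V : ℝ → ℝ}

lemma IsBddPotential.memLp_mul (hV : IsBddPotential V) {f : ℝ → ℂ} (hf : MemLp f 2 volume) :
    MemLp (fun x => (V x : ℂ) * f x) 2 volume := by
  obtain ⟨C, hC⟩ := hV.bounded
  refine hf.of_le_mul (c := C)
    ((Complex.continuous_ofReal.comp hV.continuous).aestronglyMeasurable.mul
      hf.aestronglyMeasurable) (Eventually.of_forall fun x => ?_)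
  rw [norm_mul, Complex.norm_real, Real.norm_eq_abs]
  exact mul_le_mul_of_nonneg_right (hC x) (norm_nonneg _)

lemma IsBddPotential.mem_mulDomain (hV : IsBddPotential V) (f : L2) : f ∈ mulDomain V :=
  hV.memLp_mul (Lp.memLp f)

lemma domain_schrodinger (hV : IsBddPotential V) : (schrodinger V).domain = H2 :=
  inf_eq_left.2 fun f _ => hV.mem_mulDomain f

lemma schrodinger_apply (f : (schrodinger V).domain) :
    schrodinger V f = -secondDeriv ⟨f, f.2.1⟩ + mulOp V ⟨f, f.2.2⟩ := rfl

lemma coeFn_mulOp (f : mulDomain V) :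
    (mulOp V f : ℝ → ℂ) =ᵐ[volume] fun x => (V x : ℂ) * (f : L2) x :=
  (memLp_of_mem_mulDomain f).coeFn_toLp

lemma inner_mulOp (f g : mulDomain V) :
    inner ℂ (mulOp V f) (g : L2) = inner ℂ (f : L2) (mulOp V g) := by
  rw [L2.inner_def, L2.inner_def]
  refine integral_congr_ae ?_
  filter_upwards [coeFn_mulOp f, coeFn_mulOp g] with x h1 h2
  rw [h1, h2]
  simp only [RCLike.inner_apply, map_mul, Complex.conj_ofReal]
  ring

lemma IsBddPotential.tendsto_mulOp (hV : IsBddPotential V) {f : ℕ → mulDomain V} {g : mulDomain V}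
    (h : Tendsto (fun n => (f n : L2)) atTop (𝓝 (g : L2))) :
    Tendsto (fun n => mulOp V (f n)) atTop (𝓝 (mulOp V g)) := by
  obtain ⟨C, hC⟩ := hV.bounded
  rw [tendsto_iff_norm_sub_tendsto_zero] at h ⊢
  refine squeeze_zero (fun _ => norm_nonneg _) (fun n => ?_) (by simpa using h.const_mul C)
  rw [← map_sub]
  refine Lp.norm_le_mul_norm_of_ae_le_mul ?_
  filter_upwards [coeFn_mulOp (f n - g)] with x hx
  rw [hx, norm_mul, Complex.norm_real, Real.norm_eq_abs]
  exact mul_le_mul_of_nonneg_right (hC x) (norm_nonneg _)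

lemma hasDerivAt_conj {f : ℝ → ℂ} {f' : ℂ} {x : ℝ} (h : HasDerivAt f f' x) :
    HasDerivAt (fun y => (starRingEnd ℂ) (f y)) ((starRingEnd ℂ) f') x :=
  (Complex.conjCLE : ℂ →L[ℝ] ℂ).hasFDerivAt.comp_hasDerivAt x h

lemma memLp_conj {f : ℝ → ℂ} (h : MemLp f 2 volume) :
    MemLp (fun y => (starRingEnd ℂ) (f y)) 2 volume :=
  h.of_le (Complex.continuous_conj.comp_aestronglyMeasurable h.aestronglyMeasurable)
    (Eventually.of_forall fun x => by simp)

lemma inner_toLp {f g : ℝ → ℂ} (hf : MemLp f 2 volume) (hg : MemLp g 2 volume) :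
    inner ℂ (hf.toLp f) (hg.toLp g) = ∫ x, g x * (starRingEnd ℂ) (f x) := by
  rw [L2.inner_def]
  refine integral_congr_ae ?_
  filter_upwards [hf.coeFn_toLp, hg.coeFn_toLp] with x h1 h2
  rw [h1, h2, RCLike.inner_apply]

/-- Integration by parts for `L²` functions with `L²` derivatives. -/
lemma integral_mul_conj_deriv {f f' g g' : ℝ → ℂ} (h1 : ∀ x, HasDerivAt f (f' x) x)
    (h2 : ∀ x, HasDerivAt g (g' x) x) (mf : MemLp f 2 volume) (mf' : MemLp f' 2 volume)
    (mg : MemLp g 2 volume) (mg' : MemLp g' 2 volume) :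
    ∫ x, g x * (starRingEnd ℂ) (f' x) = -∫ x, g' x * (starRingEnd ℂ) (f x) :=
  integral_mul_deriv_eq_deriv_mul_of_integrable (fun x _ => h2 x) (fun x _ => hasDerivAt_conj
    (h1 x))
    (integrable_mul_of_memLp mg (memLp_conj mf')) (integrable_mul_of_memLp mg' (memLp_conj mf))
    (integrable_mul_of_memLp mg (memLp_conj mf))

lemma inner_secondDeriv_schwartz (φ ψ : 𝓢(ℝ, ℂ)) :
    inner ℂ ((∂_{(1 : ℝ)} (∂_{(1 : ℝ)} φ)).toLp 2 volume : L2) (ψ.toLp 2 volume)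
      = inner ℂ (φ.toLp 2 volume : L2) ((∂_{(1 : ℝ)} (∂_{(1 : ℝ)} ψ)).toLp 2 volume) := by
  have m : ∀ φ : 𝓢(ℝ, ℂ), MemLp φ 2 volume := fun φ => φ.memLp 2
  refine (inner_toLp (m _) (m _)).trans (Eq.trans ?_ (inner_toLp (m _) (m _)).symm)
  have e1 := integral_mul_conj_deriv (schwartz_hasDerivAt (∂_{(1 : ℝ)} φ)) (schwartz_hasDerivAt ψ)
    (m _) (m _) (m _) (m _)
  have e2 := integral_mul_conj_deriv (schwartz_hasDerivAt φ) (schwartz_hasDerivAt (∂_{(1 : ℝ)} ψ))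
    (m _) (m _) (m _) (m _)
  rw [e1, e2, neg_neg]

lemma inner_secondDeriv (f g : H2) :
    inner ℂ (secondDeriv f) (g : L2) = inner ℂ (f : L2) (secondDeriv g) := by
  obtain ⟨φ, h1, h2⟩ := exists_schwartz_tendsto f
  obtain ⟨ψ, h3, h4⟩ := exists_schwartz_tendsto g
  refine tendsto_nhds_unique (h2.inner h3) ((h1.inner h4).congr fun n => ?_)
  exact (inner_secondDeriv_schwartz _ _).symm

lemma dense_H2 : Dense (H2 : Set L2) := by
  have hd : DenseRange (SchwartzMap.toLpCLM ℝ ℂ 2 (volume : Measure ℝ)) :=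
    SchwartzMap.denseRange_toLpCLM (by simp)
  refine hd.mono ?_
  rintro _ ⟨φ, rfl⟩
  exact toLp_mem_H2 φ

/-- Symmetry follows by approximation from Schwartz functions. For the converse inclusion, a vector
in the domain of the adjoint is compared with the `H²` solution of the equation that it satisfies
weakly. -/
theorem isSelfAdjoint_schrodinger (hV : IsBddPotential V) : IsSelfAdjoint (schrodinger V) := by
  have hdom := domain_schrodinger hV
  have hdense : Dense ((schrodinger V).domain : Set L2) := by rw [hdom]; exact dense_H2
  have hsymm : (schrodinger V).IsFormalAdjoint (schrodinger V) := by
    intro f g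
    rw [schrodinger_apply, schrodinger_apply, inner_add_left, inner_add_right, inner_neg_left,
      inner_neg_right]
    exact congrArg₂ (fun a b => -a + b) (inner_secondDeriv ⟨f, f.2.1⟩ ⟨g, g.2.1⟩)
      (inner_mulOp ⟨f, f.2.2⟩ ⟨g, g.2.2⟩)
  have hle := hsymm.le_adjoint hdense
  rw [LinearPMap.isSelfAdjoint_def]
  refine (LinearPMap.eq_of_le_of_domain_eq hle (le_antisymm hle.1 fun y hy => ?_)).symm
  have hw := LinearPMap.adjoint_isFormalAdjoint hdense ⟨y, hy⟩
  set w := (schrodinger V).adjoint ⟨y, hy⟩ with hw_def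
  set y' : mulDomain V := ⟨y, hV.mem_mulDomain y⟩
  -- Formally `w = -y'' + V y`, so `y - (2π)⁻² y''` should equal `g₀`; `x₀` is the `H²` solution of
  -- this equation.
  set g₀ : L2 := y + invFourPiSq • (w - mulOp V y') with hg₀
  set x₀ : H2 := ⟨besselInverse g₀, besselInverse_mem_H2 g₀⟩ with hx₀
  have key : ∀ x : H2, inner ℂ (y - x₀) ((x : L2) - invFourPiSq • secondDeriv x) = 0 := by
    intro x
    have hx : (x : L2) ∈ (schrodinger V).domain := by rw [hdom]; exact x.2
    have h1 := hw ⟨x, hx⟩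
    rw [schrodinger_apply, inner_add_right, inner_neg_right] at h1
    have h2 : inner ℂ (mulOp V y') (x : L2) = inner ℂ y (mulOp V ⟨x, hx.2⟩) :=
      inner_mulOp y' ⟨x, hx.2⟩
    change inner ℂ w (x : L2) = -inner ℂ y (secondDeriv x) + inner ℂ y (mulOp V ⟨x, hx.2⟩) at h1
    have h3 : inner ℂ g₀ (x : L2) = inner ℂ y ((x : L2) - invFourPiSq • secondDeriv x) := by
      rw [hg₀, inner_add_left, inner_smul_left, inner_sub_left, h1, h2, inner_sub_right,
        inner_smul_right, conj_invFourPiSq]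
      ring
    have h4 : inner ℂ g₀ (x : L2) = inner ℂ (x₀ : L2) ((x : L2) - invFourPiSq • secondDeriv x) := by
      rw [← sub_secondDeriv_besselInverse g₀, inner_sub_left, inner_smul_left, inner_sub_right,
        inner_smul_right, conj_invFourPiSq, inner_secondDeriv x₀ x]
    rw [inner_sub_left, ← h3, ← h4, sub_self]
  -- Here `x` solves `x - (2π)⁻² x'' = y - x₀`, so `key` says that `y - x₀` is orthogonal to itself.
  have h0 := key ⟨besselInverse (y - x₀), besselInverse_mem_H2 _⟩
  rw [sub_secondDeriv_besselInverse, inner_self_eq_zero, sub_eq_zero] at h0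
  rw [h0, hdom]
  exact x₀.2

lemma toLp_mem_domain (hV : IsBddPotential V) (φ : 𝓢(ℝ, ℂ)) :
    (φ.toLp 2 volume : L2) ∈ (schrodinger V).domain := by
  rw [domain_schrodinger hV]; exact toLp_mem_H2 φ

/-- Schwartz functions are a core of the operator. -/
theorem exists_schwartz_core (hV : IsBddPotential V) (f : (schrodinger V).domain) :
    ∃ φ : ℕ → 𝓢(ℝ, ℂ), Tendsto (fun n => (φ n).toLp 2 volume) atTop (𝓝 (f : L2)) ∧
      Tendsto (fun n => schrodinger V ⟨(φ n).toLp 2 volume, toLp_mem_domain hV (φ n)⟩) atTop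
        (𝓝 (schrodinger V f)) := by
  obtain ⟨φ, h1, h2⟩ := exists_schwartz_tendsto ⟨f, f.2.1⟩
  refine ⟨φ, h1, ?_⟩
  simp_rw [schrodinger_apply]
  refine Tendsto.add (h2.neg.congr fun n => ?_) (hV.tendsto_mulOp h1)
  rw [← secondDeriv_toLp]

/-- The quadratic form on classical functions. -/
theorem exists_domain_of_hasDerivAt (hV : IsBddPotential V) {f f' f'' : ℝ → ℂ}
    (h1 : ∀ x, HasDerivAt f (f' x) x) (h2 : ∀ x, HasDerivAt f' (f'' x) x) (m0 : MemLp f 2 volume)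
    (m1 : MemLp f' 2 volume) (m2 : MemLp f'' 2 volume) :
    ∃ hf : m0.toLp f ∈ (schrodinger V).domain,
      schrodinger V ⟨m0.toLp f, hf⟩ = (m2.neg.add (hV.memLp_mul m0)).toLp := by
  obtain ⟨hf, hs⟩ := toLp_mem_H2_of_hasDerivAt h1 h2 m0 m1 m2
  refine ⟨by rw [domain_schrodinger hV]; exact hf, ?_⟩
  rw [schrodinger_apply, MemLp.toLp_add m2.neg (hV.memLp_mul m0), MemLp.toLp_neg m2]
  refine congrArg₂ (fun a b => -a + b) hs ?_
  apply Lp.ext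
  filter_upwards [coeFn_mulOp ⟨m0.toLp f, hV.mem_mulDomain _⟩, (hV.memLp_mul m0).coeFn_toLp,
    m0.coeFn_toLp] with x e1 e2 e3
  rw [e1, e2, e3]

/-- The integrand of the quadratic form of `-∂ₓₓ + V`. -/
def formDensity (V : ℝ → ℝ) (f f'' : ℝ → ℂ) (x : ℝ) : ℝ :=
  -(f'' x * (starRingEnd ℂ) (f x)).re + V x * ‖f x‖ ^ 2

lemma formDensity_eq (V : ℝ → ℝ) (f f'' : ℝ → ℂ) (x : ℝ) :
    formDensity V f f'' x = (f x * (starRingEnd ℂ) (-f'' x + (V x : ℂ) * f x)).re := by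
  rw [formDensity, Complex.sq_norm, Complex.normSq_apply]
  simp only [Complex.mul_re, Complex.conj_re, Complex.conj_im, Complex.add_re, Complex.add_im,
    Complex.neg_re, Complex.neg_im, Complex.ofReal_re, Complex.ofReal_im, Complex.mul_im]
  ring

lemma integrable_formDensity (hV : IsBddPotential V) {f f'' : ℝ → ℂ} (m0 : MemLp f 2 volume)
    (m2 : MemLp f'' 2 volume) : Integrable (formDensity V f f'') := by
  have h := (integrable_mul_of_memLp m0 (memLp_conj (m2.neg.add (hV.memLp_mul m0)))).re
  refine h.congr (Eventually.of_forall fun x => ?_)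
  exact (formDensity_eq V f f'' x).symm

theorem re_inner_eq_integral (hV : IsBddPotential V) {f f'' : ℝ → ℂ} (m0 : MemLp f 2 volume)
    (m2 : MemLp f'' 2 volume) :
    (inner ℂ ((m2.neg.add (hV.memLp_mul m0)).toLp : L2) (m0.toLp f)).re
      = ∫ x, formDensity V f f'' x := by
  rw [inner_toLp]
  have h := integrable_mul_of_memLp m0 (memLp_conj (m2.neg.add (hV.memLp_mul m0)))
  refine (integral_re h).symm.trans (integral_congr_ae (Eventually.of_forall fun x => ?_))
  exact (formDensity_eq V f f'' x).symm

theorem re_inner_schwartz (hV : IsBddPotential V) (φ : 𝓢(ℝ, ℂ)) :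
    (inner ℂ (schrodinger V ⟨φ.toLp 2 volume, toLp_mem_domain hV φ⟩) (φ.toLp 2 volume : L2)).re
      = ∫ x, formDensity V φ (∂_{(1 : ℝ)} (∂_{(1 : ℝ)} φ) : 𝓢(ℝ, ℂ)) x := by
  have m : ∀ φ : 𝓢(ℝ, ℂ), MemLp φ 2 volume := fun φ => φ.memLp 2
  obtain ⟨hf, e⟩ := exists_domain_of_hasDerivAt hV (schwartz_hasDerivAt φ)
    (schwartz_hasDerivAt (∂_{(1 : ℝ)} φ)) (m _) (m _) (m _)
  rw [← re_inner_eq_integral hV (m _) (m _), ← e]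
  rfl

lemma norm_sq_toLp {f : ℝ → ℂ} (hf : MemLp f 2 volume) : ‖hf.toLp f‖ ^ 2 = ∫ x, ‖f x‖ ^ 2 := by
  have h := inner_toLp hf hf
  have h2 : (‖hf.toLp f‖ ^ 2 : ℝ) = (inner ℂ (hf.toLp f) (hf.toLp f)).re :=
    (inner_self_eq_norm_sq (𝕜 := ℂ) (hf.toLp f)).symm
  rw [h2, h]
  refine (integral_re (integrable_mul_of_memLp hf (memLp_conj hf))).symm.trans
    (integral_congr_ae (Eventually.of_forall fun x => ?_))
  change (f x * (starRingEnd ℂ) (f x)).re = ‖f x‖ ^ 2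
  rw [Complex.mul_conj, Complex.ofReal_re, Complex.sq_norm]

lemma norm_sq_schwartz (φ : 𝓢(ℝ, ℂ)) : ‖(φ.toLp 2 volume : L2)‖ ^ 2 = ∫ x, ‖φ x‖ ^ 2 :=
  norm_sq_toLp (φ.memLp 2)

end Schrodinger

/-! ### Lower bounds for the quadratic form by a solution of the equation -/

section Riccati

open Filter Topology

/-- `F + ∫₀ˣ G` is nondecreasing on the open half-line, so its limit `l` at `0⁺` is at most its
limit at infinity. Only a one-sided limit of `F` is used, because the flux may be singular at the
origin. -/
lemma le_integral_Ioi {F F' G : ℝ → ℝ} {l : ℝ} (hF : ∀ x > 0, HasDerivAt F (F' x) x)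
    (hle : ∀ x > 0, -F' x ≤ G x) (hG : Continuous G) (h_int : IntegrableOn G (Set.Ioi 0))
    (h0 : Tendsto F (𝓝[>] 0) (𝓝 l)) (htop : Tendsto F atTop (𝓝 0)) :
    l ≤ ∫ x in Set.Ioi 0, G x := by
  set H : ℝ → ℝ := fun x => F x + ∫ y in (0 : ℝ)..x, G y with hH
  have hd : ∀ x > 0, HasDerivAt H (F' x + G x) x := fun x hx =>
    (hF x hx).add (hG.integral_hasStrictDerivAt 0 x).hasDerivAt
  have hmono : MonotoneOn H (Set.Ioi 0) := by
    refine monotoneOn_of_deriv_nonneg (convex_Ioi 0)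
      (fun x hx => (hd x hx).continuousAt.continuousWithinAt) ?_ ?_
    · rw [interior_Ioi]
      exact fun x hx => (hd x hx).differentiableAt.differentiableWithinAt
    · rw [interior_Ioi]
      intro x hx
      rw [(hd x hx).deriv]
      linarith [hle x hx]
  have hlim0 : Tendsto H (𝓝[>] 0) (𝓝 l) := by
    have hc : Continuous fun x => ∫ y in (0 : ℝ)..x, G y :=
      continuous_iff_continuousAt.2
        fun x => (hG.integral_hasStrictDerivAt 0 x).hasDerivAt.continuousAt
    have h1 : Tendsto (fun x => ∫ y in (0 : ℝ)..x, G y) (𝓝[>] 0) (𝓝 0) := by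
      have := hc.tendsto 0
      rw [intervalIntegral.integral_same] at this
      exact this.mono_left nhdsWithin_le_nhds
    simpa using h0.add h1
  have hlimtop : Tendsto H atTop (𝓝 (∫ x in Set.Ioi 0, G x)) := by
    simpa using htop.add (intervalIntegral_tendsto_integral_Ioi 0 h_int tendsto_id)
  refine ge_of_tendsto hlimtop ?_
  filter_upwards [eventually_gt_atTop 0] with x hx
  refine le_of_tendsto hlim0 ?_
  filter_upwards [Ioo_mem_nhdsGT hx] with y hy
  exact hmono hy.1 hx hy.2.le

/-- The flux `Re (f' f̄) - (p'/p) |f|²`. -/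
def flux (p p' : ℝ → ℝ) (f f' : ℝ → ℂ) (x : ℝ) : ℝ :=
  ((f' x - ((p' x / p x : ℝ) : ℂ) * f x) * (starRingEnd ℂ) (f x)).re

variable {W p p' : ℝ → ℝ} {f f' f'' : ℝ → ℂ}

/-- The quotient `w = p'/p` solves the Riccati equation `w' = W - w²`; completing the square, minus
the derivative of the flux is the form density minus `|f' - w f|²`. -/
lemma exists_hasDerivAt_flux {x : ℝ} (hp : HasDerivAt p (p' x) x)
    (hp' : HasDerivAt p' (W x * p x) x) (h0 : p x ≠ 0) (h1 : HasDerivAt f (f' x) x)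
    (h2 : HasDerivAt f' (f'' x) x) :
    ∃ D, HasDerivAt (flux p p' f f') D x ∧ -D ≤ formDensity W f f'' x := by
  have hw := (hp'.div hp h0).ofReal_comp
  have hF := (((h2.sub (hw.mul h1)).mul (hasDerivAt_conj h1)))
  have hre := (Complex.reCLM.hasFDerivAt.comp_hasDerivAt x hF)
  refine ⟨_, hre, ?_⟩
  set w : ℝ := p' x / p x with hw_def
  have e : (W x * p x * p x - p' x * p' x) / p x ^ 2 = W x - w ^ 2 := by
    rw [hw_def]; field_simp
  simp only [Pi.div_apply, e, Complex.reCLM_apply, formDensity]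
  rw [Complex.sq_norm, Complex.normSq_apply]
  simp only [Pi.mul_apply, Pi.sub_apply, Complex.mul_re, Complex.mul_im, Complex.sub_re,
    Complex.sub_im, Complex.add_re, Complex.add_im, Complex.conj_re, Complex.conj_im,
    Complex.ofReal_re, Complex.ofReal_im, Complex.ofReal_sub, Complex.ofReal_pow, ← hw_def]
  simp only [← Complex.ofReal_pow, Complex.ofReal_re, Complex.ofReal_im]
  nlinarith [sq_nonneg ((f' x).re - w * (f x).re), sq_nonneg ((f' x).im - w * (f x).im)]

lemma continuous_formDensity (hW : Continuous W) (hf : Continuous f) (hf'' : Continuous f'') :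
    Continuous (formDensity W f f'') := by
  unfold formDensity
  exact ((Complex.continuous_re.comp (hf''.mul (Complex.continuous_conj.comp hf))).neg).add
    (hW.mul (hf.norm.pow 2))

lemma tendsto_flux_atTop (hb : ∃ C, ∀ᶠ x in atTop, |p' x / p x| ≤ C)
    (hf : Tendsto f atTop (𝓝 0)) (hf' : Tendsto f' atTop (𝓝 0)) :
    Tendsto (flux p p' f f') atTop (𝓝 0) := by
  obtain ⟨C, hC⟩ := hb
  have h1 : Tendsto (fun x => ((p' x / p x : ℝ) : ℂ) * f x) atTop (𝓝 0) := by
    refine squeeze_zero_norm' (a := fun x => C * ‖f x‖) ?_ (by simpa using hf.norm.const_mul C)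
    filter_upwards [hC] with x hx
    rw [norm_mul, Complex.norm_real, Real.norm_eq_abs]
    exact mul_le_mul_of_nonneg_right hx (norm_nonneg _)
  have h2 := (hf'.sub h1).mul ((Complex.continuous_conj.tendsto 0).comp hf)
  have h3 := (Complex.continuous_re.tendsto _).comp h2
  rw [sub_zero, zero_mul, Complex.zero_re] at h3
  exact h3

/-- On a half-line where `p'' = W p` has no zeros, the form is at least the boundary flux. -/
lemma flux_le_integral_Ioi {l : ℝ} (hW : Continuous W) (hp : ∀ x, HasDerivAt p (p' x) x)
    (hp' : ∀ x, HasDerivAt p' (W x * p x) x) (h0 : ∀ x > 0, p x ≠ 0)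
    (h1 : ∀ x, HasDerivAt f (f' x) x) (h2 : ∀ x, HasDerivAt f' (f'' x) x) (hc : Continuous f'')
    (h_int : Integrable (formDensity W f f''))
    (hb : ∃ C, ∀ᶠ x in atTop, |p' x / p x| ≤ C) (hf : Tendsto f atTop (𝓝 0))
    (hf' : Tendsto f' atTop (𝓝 0)) (hl : Tendsto (flux p p' f f') (𝓝[>] 0) (𝓝 l)) :
    l ≤ ∫ x in Set.Ioi 0, formDensity W f f'' x := by
  have hD : ∀ x, ∃ D, 0 < x → HasDerivAt (flux p p' f f') D x ∧ -D ≤ formDensity W f f'' x := by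
    intro x
    by_cases hx : 0 < x
    · obtain ⟨D, hD⟩ := exists_hasDerivAt_flux (hp x) (hp' x) (h0 x hx) (h1 x) (h2 x)
      exact ⟨D, fun _ => hD⟩
    · exact ⟨0, fun h => absurd h hx⟩
  choose D hD using hD
  have hfc : Continuous f := continuous_iff_continuousAt.2 fun x => (h1 x).continuousAt
  exact le_integral_Ioi (fun x hx => (hD x hx).1) (fun x hx => (hD x hx).2)
    (continuous_formDensity hW hfc hc) h_int.integrableOn hl (tendsto_flux_atTop hb hf hf')

lemma hasDerivAt_comp_neg {E : Type*} [NormedAddCommGroup E] [NormedSpace ℝ E] {g g' : ℝ → E}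
    (h : ∀ x, HasDerivAt g (g' x) x) (x : ℝ) : HasDerivAt (fun y => g (-y)) (-g' (-x)) x := by
  have := (h (-x)).scomp x (hasDerivAt_neg x)
  rw [neg_one_smul] at this
  exact this

/-- The bound on both half-lines, with the boundary fluxes at the origin. -/
lemma flux_le_integral {l r : ℝ} (hW : Continuous W) (hp : ∀ x, HasDerivAt p (p' x) x)
    (hp' : ∀ x, HasDerivAt p' (W x * p x) x) (h0 : ∀ x ≠ 0, p x ≠ 0)
    (h_int : ∀ φ : 𝓢(ℝ, ℂ), Integrable (formDensity W φ (∂_{(1 : ℝ)} (∂_{(1 : ℝ)} φ) : 𝓢(ℝ, ℂ))))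
    (hb : ∃ C, ∀ᶠ x in atTop, |p' x / p x| ≤ C) (hb' : ∃ C, ∀ᶠ x in atBot, |p' x / p x| ≤ C)
    (φ : 𝓢(ℝ, ℂ)) (hr : Tendsto (flux p p' φ (∂_{(1 : ℝ)} φ : 𝓢(ℝ, ℂ))) (𝓝[>] 0) (𝓝 r))
    (hl : Tendsto (flux p p' φ (∂_{(1 : ℝ)} φ : 𝓢(ℝ, ℂ))) (𝓝[<] 0) (𝓝 l)) :
    r - l ≤ ∫ x, formDensity W φ (∂_{(1 : ℝ)} (∂_{(1 : ℝ)} φ) : 𝓢(ℝ, ℂ)) x := by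
  have hz : ∀ ψ : 𝓢(ℝ, ℂ), Tendsto ψ (cocompact ℝ) (𝓝 0) := fun ψ => zero_at_infty ψ.toZeroAtInfty
  have h1 := flux_le_integral_Ioi hW hp hp' (fun x hx => h0 x hx.ne') (schwartz_hasDerivAt φ)
    (schwartz_hasDerivAt _) (SchwartzMap.continuous _) (h_int φ) hb
    ((hz φ).mono_left atTop_le_cocompact) ((hz _).mono_left atTop_le_cocompact) hr
  have e : ∀ x, formDensity (fun y => W (-y)) (fun y => φ (-y))
      (fun y => - -(∂_{(1 : ℝ)} (∂_{(1 : ℝ)} φ) : 𝓢(ℝ, ℂ)) (-y)) x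
      = formDensity W φ (∂_{(1 : ℝ)} (∂_{(1 : ℝ)} φ) : 𝓢(ℝ, ℂ)) (-x) := fun x => by
    simp only [formDensity, neg_neg]
  have hneg : Tendsto (fun x : ℝ => -x) (𝓝[>] 0) (𝓝[<] 0) := by
    simpa using tendsto_neg_nhdsGT (a := (0 : ℝ))
  -- The left half-line is treated after `x ↦ -x`, which preserves the form density and reverses the
  -- sign of the flux; hence the boundary value `-l`.
  have h2 := flux_le_integral_Ioi (W := fun y => W (-y)) (p := fun y => p (-y))
    (p' := fun y => -p' (-y)) (f := fun y => φ (-y))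
    (f' := fun y => -(∂_{(1 : ℝ)} φ : 𝓢(ℝ, ℂ)) (-y))
    (f'' := fun y => - -(∂_{(1 : ℝ)} (∂_{(1 : ℝ)} φ) : 𝓢(ℝ, ℂ)) (-y)) (l := -l)
    (hW.comp continuous_neg) (hasDerivAt_comp_neg hp)
    (fun x => by
      have := (hasDerivAt_comp_neg hp' x).neg
      rw [neg_neg] at this
      exact this)
    (fun x hx => h0 _ (by linarith)) (hasDerivAt_comp_neg (schwartz_hasDerivAt φ))
    (fun x => (hasDerivAt_comp_neg (schwartz_hasDerivAt _) x).neg)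
    (((SchwartzMap.continuous _).comp continuous_neg).neg.neg)
    (by
      have := (h_int φ).comp_neg
      refine this.congr (Eventually.of_forall fun x => (e x).symm))
    (by
      obtain ⟨C, hC⟩ := hb'
      refine ⟨C, ?_⟩
      filter_upwards [tendsto_neg_atTop_atBot.eventually hC] with x hx
      rwa [neg_div, abs_neg])
    (((hz φ).mono_left atBot_le_cocompact).comp tendsto_neg_atTop_atBot)
    (by simpa using (((hz (∂_{(1 : ℝ)} φ)).mono_left atBot_le_cocompact).comp
      tendsto_neg_atTop_atBot).neg)
    (by
      refine ((hl.comp hneg).neg).congr fun x => ?_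
      simp only [flux, Function.comp_apply, neg_div, Complex.ofReal_neg]
      rw [← Complex.neg_re]
      congr 1
      ring)
  simp_rw [e] at h2
  rw [integral_comp_neg_Ioi (c := (0 : ℝ))
    (f := formDensity W φ (∂_{(1 : ℝ)} (∂_{(1 : ℝ)} φ) : 𝓢(ℝ, ℂ))), neg_zero] at h2
  have h3 := intervalIntegral.integral_Iic_add_Ioi (b := (0 : ℝ)) (h_int φ).integrableOn
    (h_int φ).integrableOn
  linarith

end Riccati

/-! ### From Riccati bounds on Schwartz functions to forms on the whole domain -/

section Comparison

open Filter Topology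

variable {V W p p' : ℝ → ℝ}

lemma integrable_formDensity_schwartz (hV : IsBddPotential V) (φ : 𝓢(ℝ, ℂ)) :
    Integrable (formDensity V φ (∂_{(1 : ℝ)} (∂_{(1 : ℝ)} φ) : 𝓢(ℝ, ℂ))) :=
  integrable_formDensity hV (φ.memLp 2) (SchwartzMap.memLp _ 2 volume)

/-- Since `φ` vanishes where `p` has a simple zero, a quotient of difference quotients shows that
`(p'/p) φ` tends to `φ' 0`; the remaining factor `φ̄` tends to `0`. -/
lemma tendsto_flux_nhdsNE (hp : HasDerivAt p (p' 0) 0) (hp' : ContinuousAt p' 0) (hp0 : p 0 = 0)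
    (hp0' : p' 0 ≠ 0) {φ : 𝓢(ℝ, ℂ)} (hφ : φ 0 = 0) :
    Tendsto (flux p p' φ (∂_{(1 : ℝ)} φ : 𝓢(ℝ, ℂ))) (𝓝[≠] 0) (𝓝 0) := by
  have s1 := hasDerivAt_iff_tendsto_slope_zero.1 hp
  have s2 := hasDerivAt_iff_tendsto_slope_zero.1 (schwartz_hasDerivAt φ 0)
  simp only [zero_add, hp0, hφ, sub_zero] at s1 s2
  have t1 : Tendsto (fun x => ((p' x / p x : ℝ) : ℂ) * φ x) (𝓝[≠] 0)
      (𝓝 (((p' 0 / p' 0 : ℝ) : ℂ) * ∂_{(1 : ℝ)} φ 0)) := by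
    have hc : Tendsto p' (𝓝[≠] 0) (𝓝 (p' 0)) := hp'.tendsto.mono_left nhdsWithin_le_nhds
    refine (((Complex.continuous_ofReal.tendsto _).comp (hc.div s1 hp0')).mul s2).congr' ?_
    filter_upwards [self_mem_nhdsWithin] with x hx
    have hx : x ≠ 0 := hx
    have hx' : (x : ℂ) ≠ 0 := by exact_mod_cast hx
    simp only [Function.comp_apply, Pi.div_apply, smul_eq_mul, Complex.real_smul]
    push_cast
    rw [div_mul_eq_div_div_swap, div_inv_eq_mul]
    field_simp
  have t2 : Tendsto (fun x => (starRingEnd ℂ) (φ x)) (𝓝[≠] 0) (𝓝 0) := by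
    have := (Complex.continuous_conj.comp φ.continuous).tendsto 0
    simp only [Function.comp_apply, hφ, map_zero] at this
    exact this.mono_left nhdsWithin_le_nhds
  have t3 : Tendsto (∂_{(1 : ℝ)} φ : 𝓢(ℝ, ℂ)) (𝓝[≠] 0) (𝓝 (∂_{(1 : ℝ)} φ 0)) :=
    ((SchwartzMap.continuous _).tendsto 0).mono_left nhdsWithin_le_nhds
  have t4 := (Complex.continuous_re.tendsto _).comp ((t3.sub t1).mul t2)
  rw [mul_zero, Complex.zero_re] at t4
  exact t4

/-- If `p'' = V p` has a single simple zero at the origin, then the form is nonnegative on the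
functions that vanish there. -/
lemma integral_nonneg_of_apply_zero (hV : IsBddPotential V) (hp : ∀ x, HasDerivAt p (p' x) x)
    (hp' : ∀ x, HasDerivAt p' (V x * p x) x) (h0 : ∀ x ≠ 0, p x ≠ 0) (hp0 : p 0 = 0)
    (hp0' : p' 0 ≠ 0) (hb : ∃ C, ∀ᶠ x in atTop, |p' x / p x| ≤ C)
    (hb' : ∃ C, ∀ᶠ x in atBot, |p' x / p x| ≤ C) {φ : 𝓢(ℝ, ℂ)} (hφ : φ 0 = 0) :
    0 ≤ ∫ x, formDensity V φ (∂_{(1 : ℝ)} (∂_{(1 : ℝ)} φ) : 𝓢(ℝ, ℂ)) x := by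
  have ht := tendsto_flux_nhdsNE (hp 0) (hp' 0).continuousAt hp0 hp0' hφ
  have := flux_le_integral hV.continuous hp hp' h0 (integrable_formDensity_schwartz hV) hb hb' φ
    (ht.mono_left (nhdsWithin_mono _ fun x hx => (Set.mem_Ioi.1 hx).ne'))
    (ht.mono_left (nhdsWithin_mono _ fun x hx => (Set.mem_Iio.1 hx).ne))
  linarith

lemma exists_combination_eq_zero (x y : ℂ) :
    ∃ q ∈ Metric.sphere (0 : ℂ × ℂ) 1, q.1 * x + q.2 * y = 0 := by
  by_cases h : ((y, -x) : ℂ × ℂ) = 0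
  · have hx : x = 0 := by simpa using congrArg Prod.snd h
    have hy : y = 0 := congrArg Prod.fst h
    exact ⟨(1, 0), by simp [Prod.norm_def], by simp [hx, hy]⟩
  · have hn : ‖((y, -x) : ℂ × ℂ)‖ ≠ 0 := norm_ne_zero_iff.2 h
    refine ⟨((‖((y, -x) : ℂ × ℂ)‖⁻¹ : ℝ) : ℂ) • (y, -x), ?_, ?_⟩
    · rw [mem_sphere_zero_iff_norm, norm_smul, Complex.norm_real, norm_inv, norm_norm,
        inv_mul_cancel₀ hn]
    · simp only [Prod.smul_mk, smul_eq_mul]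
      ring

/-- The form is nonnegative on a nontrivial combination of any two vectors, if it is nonnegative
on the Schwartz functions that vanish at the origin. -/
theorem exists_combination_nonneg (hV : IsBddPotential V)
    (h : ∀ φ : 𝓢(ℝ, ℂ), φ 0 = 0 →
      0 ≤ ∫ x, formDensity V φ (∂_{(1 : ℝ)} (∂_{(1 : ℝ)} φ) : 𝓢(ℝ, ℂ)) x)
    (f g : (schrodinger V).domain) : ∃ a b : ℂ, (a ≠ 0 ∨ b ≠ 0) ∧
      0 ≤ (inner ℂ (schrodinger V (a • f + b • g))
        ((a • f + b • g : (schrodinger V).domain) : L2)).re := by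
  obtain ⟨φ, hφ, hAφ⟩ := exists_schwartz_core hV f
  obtain ⟨ψ, hψ, hAψ⟩ := exists_schwartz_core hV g
  -- Vanishing at the origin is imposed on the Schwartz approximants, not on `f` and `g`. The
  -- coefficients lie on a compact sphere, so a limit exists, is nonzero, and inherits nonnegativity
  -- by graph convergence.
  choose q hq hq0 using fun n => exists_combination_eq_zero (φ n 0) (ψ n 0)
  obtain ⟨r, hr, θ, hθ, hlim⟩ := (isCompact_sphere (0 : ℂ × ℂ) 1).tendsto_subseq hq
  have hr1 : Tendsto (fun n => (q (θ n)).1) atTop (𝓝 r.1) := (continuous_fst.tendsto r).comp hlim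
  have hr2 : Tendsto (fun n => (q (θ n)).2) atTop (𝓝 r.2) := (continuous_snd.tendsto r).comp hlim
  refine ⟨r.1, r.2, ?_, ?_⟩
  · by_contra! hcon
    have : r = 0 := Prod.ext hcon.1 hcon.2
    rw [this, mem_sphere_zero_iff_norm, norm_zero] at hr
    exact zero_ne_one hr
  · have hθ' := hθ.tendsto_atTop
    have l1 := (hr1.smul (hφ.comp hθ')).add (hr2.smul (hψ.comp hθ'))
    have l2 := (hr1.smul (hAφ.comp hθ')).add (hr2.smul (hAψ.comp hθ'))
    have e : schrodinger V (r.1 • f + r.2 • g) = r.1 • schrodinger V f + r.2 • schrodinger V g := by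
      rw [LinearPMap.map_add, LinearPMap.map_smul, LinearPMap.map_smul]
    rw [e]
    refine ge_of_tendsto ((Complex.continuous_re.tendsto _).comp (l2.inner (𝕜 := ℂ) l1))
      (Eventually.of_forall fun n => ?_)
    have h1 := h ((q (θ n)).1 • φ (θ n) + (q (θ n)).2 • ψ (θ n)) (hq0 (θ n))
    rw [← re_inner_schwartz hV] at h1
    refine h1.trans_eq ?_
    simp only [Function.comp_apply]
    rw [← LinearPMap.map_smul, ← LinearPMap.map_smul, ← LinearPMap.map_add]
    rfl

lemma re_inner_ge_of_schwartz (hV : IsBddPotential V) {K : L2 →L[ℂ] L2} {κ : ℝ}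
    (h : ∀ φ : 𝓢(ℝ, ℂ), κ * ∫ x, ‖φ x‖ ^ 2 ≤
      (∫ x, formDensity V φ (∂_{(1 : ℝ)} (∂_{(1 : ℝ)} φ) : 𝓢(ℝ, ℂ)) x)
        + (inner ℂ (K (φ.toLp 2 volume)) (φ.toLp 2 volume : L2)).re)
    (f : (schrodinger V).domain) :
    κ * ‖(f : L2)‖ ^ 2 ≤ (inner ℂ (schrodinger V f + K f) (f : L2)).re := by
  obtain ⟨φ, hφ, hAφ⟩ := exists_schwartz_core hV f
  have hK := (K.continuous.tendsto _).comp hφ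
  refine le_of_tendsto_of_tendsto ((hφ.norm.pow 2).const_mul κ)
    ((Complex.continuous_re.tendsto _).comp ((hAφ.add hK).inner (𝕜 := ℂ) hφ))
    (Eventually.of_forall fun n => ?_)
  have h1 := h (φ n)
  rw [← re_inner_schwartz hV, ← norm_sq_schwartz] at h1
  simpa only [Function.comp_apply, inner_add_left, Complex.add_re] using h1

/-- If `p'' = W p` has a positive solution and `V ≥ W + κ`, then `-∂ₓₓ + V ≥ κ`. -/
theorem re_inner_ge_of_pos_solution (hV : IsBddPotential V) (hW : IsBddPotential W) {κ : ℝ}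
    (hκ : ∀ x, κ ≤ V x - W x) (hp : ∀ x, HasDerivAt p (p' x) x)
    (hp' : ∀ x, HasDerivAt p' (W x * p x) x) (h0 : ∀ x, p x ≠ 0)
    (hb : ∃ C, ∀ x, |p' x / p x| ≤ C) (f : (schrodinger V).domain) :
    κ * ‖(f : L2)‖ ^ 2 ≤ (inner ℂ (schrodinger V f) (f : L2)).re := by
  have := re_inner_ge_of_schwartz hV (K := 0) (κ := κ) (fun φ => ?_) f
  · simpa using this
  obtain ⟨C, hC⟩ := hb
  have hcont : Continuous (flux p p' φ (∂_{(1 : ℝ)} φ : 𝓢(ℝ, ℂ))) := by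
    have c1 : Continuous p := continuous_iff_continuousAt.2 fun x => (hp x).continuousAt
    have c2 : Continuous p' := continuous_iff_continuousAt.2 fun x => (hp' x).continuousAt
    have c3 : Continuous fun x => p' x / p x := c2.div c1 h0
    exact Complex.continuous_re.comp (((SchwartzMap.continuous _).sub
      ((Complex.continuous_ofReal.comp c3).mul φ.continuous)).mul
      (Complex.continuous_conj.comp φ.continuous))
  -- Because `p` has no zero, the flux is continuous at the origin and its two one-sided limits
  -- cancel.
  have h1 := flux_le_integral hW.continuous hp hp' (fun x _ => h0 x)
    (integrable_formDensity_schwartz hW) ⟨C, Eventually.of_forall hC⟩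
    ⟨C, Eventually.of_forall hC⟩ φ ((hcont.tendsto 0).mono_left nhdsWithin_le_nhds)
    ((hcont.tendsto 0).mono_left nhdsWithin_le_nhds)
  have hsq : Integrable fun x => ‖φ x‖ ^ 2 := (φ.memLp 2).integrable_norm_pow two_ne_zero
  have h2 : κ * ∫ x, ‖φ x‖ ^ 2 ≤
      (∫ x, formDensity V φ (∂_{(1 : ℝ)} (∂_{(1 : ℝ)} φ) : 𝓢(ℝ, ℂ)) x)
      - ∫ x, formDensity W φ (∂_{(1 : ℝ)} (∂_{(1 : ℝ)} φ) : 𝓢(ℝ, ℂ)) x := by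
    rw [← integral_sub (integrable_formDensity_schwartz hV φ)
      (integrable_formDensity_schwartz hW φ), ← integral_const_mul]
    refine integral_mono (hsq.const_mul κ) ((integrable_formDensity_schwartz hV φ).sub
      (integrable_formDensity_schwartz hW φ)) fun x => ?_
    simp only [formDensity]
    nlinarith [hκ x, sq_nonneg ‖φ x‖]
  simp only [zero_apply, inner_zero_left, Complex.zero_re, add_zero]
  linarith

end Comparison

/-! ### Positivity up to a finite-rank perturbation -/

section Poincare

open Filter Topology

/-- Cauchy–Schwarz, read off from `∫ (‖g‖ - k)² ≥ 0` with `k` the mean of `‖g‖`. -/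
lemma sq_integral_norm_le {g : ℝ → ℂ} (hg : Continuous g) {a b : ℝ} (hab : a < b) :
    (∫ x in a..b, ‖g x‖) ^ 2 ≤ (b - a) * ∫ x in a..b, ‖g x‖ ^ 2 := by
  set m := ∫ x in a..b, ‖g x‖ with hm
  set k := m / (b - a) with hk
  have hl : 0 < b - a := sub_pos.2 hab
  have i1 : IntervalIntegrable (fun x => ‖g x‖ ^ 2) volume a b :=
    (hg.norm.pow 2).intervalIntegrable _ _
  have i2 : IntervalIntegrable (fun x => ‖g x‖) volume a b := hg.norm.intervalIntegrable _ _
  have h : 0 ≤ ∫ x in a..b, (‖g x‖ - k) ^ 2 :=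
    intervalIntegral.integral_nonneg hab.le fun x _ => sq_nonneg _
  have e : ∫ x in a..b, (‖g x‖ - k) ^ 2
      = (∫ x in a..b, ‖g x‖ ^ 2) - 2 * k * m + (b - a) * k ^ 2 := by
    have : ∀ x, (‖g x‖ - k) ^ 2 = ‖g x‖ ^ 2 - 2 * k * ‖g x‖ + k ^ 2 := fun x => by ring
    simp_rw [this]
    rw [intervalIntegral.integral_add (i1.sub (i2.const_mul _)) (by simp),
      intervalIntegral.integral_sub i1 (i2.const_mul _), intervalIntegral.integral_const_mul,
      intervalIntegral.integral_const, smul_eq_mul]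
  rw [e] at h
  have hkm : k * (b - a) = m := by rw [hk]; field_simp
  nlinarith

/-- The Poincaré inequality on an interval. -/
lemma poincare_interval {f f' : ℝ → ℂ} (h1 : ∀ x, HasDerivAt f (f' x) x) (hc : Continuous f')
    {a b : ℝ} (hab : a < b) :
    (b - a) * ∫ x in a..b, ‖f x‖ ^ 2 ≤
      2 * ‖∫ x in a..b, f x‖ ^ 2 + 2 * (b - a) ^ 3 * ∫ x in a..b, ‖f' x‖ ^ 2 := by
  have hl : 0 < b - a := sub_pos.2 hab
  have hf : Continuous f := continuous_iff_continuousAt.2 fun x => (h1 x).continuousAt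
  set m := ‖∫ x in a..b, f x‖ with hm
  set E := ∫ x in a..b, ‖f' x‖ ^ 2 with hE
  set N := ∫ x in a..b, ‖f' x‖ with hN
  have hN2 : N ^ 2 ≤ (b - a) * E := sq_integral_norm_le hc hab
  -- The oscillation of `f` is at most `N = ∫ ‖f'‖`, so `f` is bounded pointwise by its mean plus
  -- `N`; this is then squared and integrated.
  have hosc : ∀ x ∈ Set.Icc a b, ∀ y ∈ Set.Icc a b, ‖f x - f y‖ ≤ N := by
    intro x hx y hy
    have e : ∫ t in y..x, f' t = f x - f y :=
      intervalIntegral.integral_eq_sub_of_hasDerivAt (fun t _ => h1 t) (hc.intervalIntegrable _ _)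
    rw [← e, hN]
    refine intervalIntegral.norm_integral_le_integral_norm_uIoc.trans ?_
    rw [intervalIntegral.integral_of_le hab.le]
    refine setIntegral_mono_set ((hc.norm.intervalIntegrable a b).1)
      (Eventually.of_forall fun _ => norm_nonneg _) (LE.le.eventuallyLE ?_)
    intro t ht
    rw [Set.mem_uIoc] at ht
    rcases ht with ht | ht
    · exact ⟨hy.1.trans_lt ht.1, ht.2.trans hx.2⟩
    · exact ⟨hx.1.trans_lt ht.1, ht.2.trans hy.2⟩
  have hpt : ∀ x ∈ Set.Icc a b, (b - a) * ‖f x‖ ≤ m + (b - a) * N := by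
    intro x hx
    have e : ((b - a : ℝ) : ℂ) * f x = (∫ y in a..b, f y) + ∫ y in a..b, (f x - f y) := by
      rw [intervalIntegral.integral_sub (by simp) (hf.intervalIntegrable _ _),
        intervalIntegral.integral_const, Complex.real_smul]
      ring
    have hle : ‖∫ y in a..b, (f x - f y)‖ ≤ N * |b - a| :=
      intervalIntegral.norm_integral_le_of_norm_le_const fun y hy => by
        rw [Set.uIoc_of_le hab.le] at hy
        exact hosc x hx y ⟨hy.1.le, hy.2⟩
    rw [abs_of_pos hl] at hle
    calc (b - a) * ‖f x‖ = ‖((b - a : ℝ) : ℂ) * f x‖ := by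
          rw [norm_mul, Complex.norm_real, Real.norm_eq_abs, abs_of_pos hl]
      _ ≤ _ := by
          rw [e]
          refine (norm_add_le _ _).trans ?_
          linarith
  have hsq : ∀ x ∈ Set.Icc a b,
      (b - a) ^ 2 * ‖f x‖ ^ 2 ≤ 2 * m ^ 2 + 2 * (b - a) ^ 3 * E := by
    intro x hx
    have h := hpt x hx
    have h2 : ((b - a) * ‖f x‖) ^ 2 ≤ (m + (b - a) * N) ^ 2 :=
      pow_le_pow_left₀ (by positivity) h 2
    have h3 : (b - a) ^ 2 * N ^ 2 ≤ (b - a) ^ 2 * ((b - a) * E) := by gcongr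
    nlinarith [sq_nonneg (m - (b - a) * N)]
  have h_int : ∫ x in a..b, (b - a) ^ 2 * ‖f x‖ ^ 2 ≤
      ∫ _x in a..b, (2 * m ^ 2 + 2 * (b - a) ^ 3 * E) :=
    intervalIntegral.integral_mono_on hab.le
      ((continuous_const.mul (hf.norm.pow 2)).intervalIntegrable _ _) (by simp) hsq
  rw [intervalIntegral.integral_const_mul, intervalIntegral.integral_const, smul_eq_mul] at h_int
  refine le_of_mul_le_mul_left ?_ hl
  calc _ = (b - a) ^ 2 * ∫ x in a..b, ‖f x‖ ^ 2 := by ring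
    _ ≤ _ := h_int

/-- On a short enough interval the kinetic energy absorbs the mass `m ∫ ‖f‖²` up to the single
functional `∫ f`, which a rank-one operator can compensate. -/
lemma poincare_interval_weighted {f f' : ℝ → ℂ} (h1 : ∀ x, HasDerivAt f (f' x) x)
    (hc : Continuous f') {a b m : ℝ} (hm : 0 ≤ m) (hab : a < b) (hsmall : 2 * (b - a) ^ 2 * m ≤ 1) :
    m * ∫ x in a..b, ‖f x‖ ^ 2 ≤
      2 * m / (b - a) * ‖∫ x in a..b, f x‖ ^ 2 + ∫ x in a..b, ‖f' x‖ ^ 2 := by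
  have hl : 0 < b - a := sub_pos.2 hab
  have h := mul_le_mul_of_nonneg_left (poincare_interval h1 hc hab) hm
  have hE : 0 ≤ ∫ x in a..b, ‖f' x‖ ^ 2 :=
    intervalIntegral.integral_nonneg hab.le fun x _ => sq_nonneg _
  refine le_of_mul_le_mul_left ?_ hl
  have e : (b - a) * (2 * m / (b - a) * ‖∫ x in a..b, f x‖ ^ 2 + ∫ x in a..b, ‖f' x‖ ^ 2)
      = 2 * m * ‖∫ x in a..b, f x‖ ^ 2 + (b - a) * ∫ x in a..b, ‖f' x‖ ^ 2 := by field_simp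
  rw [e]
  have h2 : (b - a) * (2 * (b - a) ^ 2 * m) * ∫ x in a..b, ‖f' x‖ ^ 2
      ≤ (b - a) * 1 * ∫ x in a..b, ‖f' x‖ ^ 2 := by gcongr
  nlinarith

lemma integral_formDensity_schwartz {V : ℝ → ℝ} (hV : IsBddPotential V) (φ : 𝓢(ℝ, ℂ)) :
    ∫ x, formDensity V φ (∂_{(1 : ℝ)} (∂_{(1 : ℝ)} φ) : 𝓢(ℝ, ℂ)) x
      = ∫ x, (‖(∂_{(1 : ℝ)} φ : 𝓢(ℝ, ℂ)) x‖ ^ 2 + V x * ‖φ x‖ ^ 2) := by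
  have m : ∀ φ : 𝓢(ℝ, ℂ), MemLp φ 2 volume := fun φ => φ.memLp 2
  set d : 𝓢(ℝ, ℂ) := ∂_{(1 : ℝ)} φ with hd
  have e1 : ∫ x, d x * (starRingEnd ℂ) (d x)
      = -∫ x, (∂_{(1 : ℝ)} d : 𝓢(ℝ, ℂ)) x * (starRingEnd ℂ) (φ x) :=
    integral_mul_conj_deriv (schwartz_hasDerivAt φ) (schwartz_hasDerivAt d) (m _) (m _) (m _) (m _)
  have e2 := congrArg Complex.re e1
  rw [Complex.neg_re] at e2
  have i1 := integrable_mul_of_memLp (m d) (memLp_conj (m d))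
  have i2 := integrable_mul_of_memLp (m (∂_{(1 : ℝ)} d)) (memLp_conj (m φ))
  have e3 : (∫ x, d x * (starRingEnd ℂ) (d x)).re = ∫ x, ‖d x‖ ^ 2 := by
    refine (integral_re i1).symm.trans (integral_congr_ae (Eventually.of_forall fun x => ?_))
    change (d x * (starRingEnd ℂ) (d x)).re = ‖d x‖ ^ 2
    rw [Complex.mul_conj, Complex.ofReal_re, Complex.sq_norm]
  have e4 : (∫ x, (∂_{(1 : ℝ)} d : 𝓢(ℝ, ℂ)) x * (starRingEnd ℂ) (φ x)).re
      = ∫ x, ((∂_{(1 : ℝ)} d : 𝓢(ℝ, ℂ)) x * (starRingEnd ℂ) (φ x)).re := (integral_re i2).symm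
  rw [e3, e4] at e2
  have hsq : ∀ φ : 𝓢(ℝ, ℂ), Integrable fun x => ‖φ x‖ ^ 2 :=
    fun φ => (m φ).integrable_norm_pow two_ne_zero
  obtain ⟨C, hC⟩ := hV.bounded
  have i3 : Integrable fun x => V x * ‖φ x‖ ^ 2 :=
    (hsq φ).bdd_mul hV.continuous.aestronglyMeasurable (c := C) (Eventually.of_forall hC)
  have i4 : Integrable fun x => -((∂_{(1 : ℝ)} d : 𝓢(ℝ, ℂ)) x * (starRingEnd ℂ) (φ x)).re :=
    i2.re.neg
  simp only [formDensity]
  rw [integral_add i4 i3, integral_add (hsq d) i3, e2, integral_neg]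

/-- The finite-rank operator `M ∑ⱼ |χⱼ⟩⟨χⱼ|` built on the indicators of the intervals
`(aⱼ, aⱼ₊₁]`. -/
def intervalOp (M : ℝ) (a : ℕ → ℝ) (N : ℕ) : L2 →L[ℂ] L2 :=
  ∑ j ∈ Finset.range N, (M : ℂ) • (innerSL ℂ (indicatorConstLp 2
    (measurableSet_Ioc (a := a j) (b := a (j + 1))) measure_Ioc_lt_top.ne (1 : ℂ))).smulRight
    (indicatorConstLp 2 (measurableSet_Ioc (a :=
      a j) (b := a (j + 1))) measure_Ioc_lt_top.ne (1 : ℂ))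

lemma finiteDimensional_range_intervalOp (M : ℝ) (a : ℕ → ℝ) (N : ℕ) :
    FiniteDimensional ℂ (intervalOp M a N).range := by
  set χ : ℕ → L2 := fun j => indicatorConstLp 2
    (measurableSet_Ioc (a := a j) (b := a (j + 1))) measure_Ioc_lt_top.ne (1 : ℂ)
  have hfin : FiniteDimensional ℂ (Submodule.span ℂ (χ '' (Finset.range N : Set ℕ))) :=
    FiniteDimensional.span_of_finite ℂ ((Finset.range N).finite_toSet.image χ)
  refine Submodule.finiteDimensional_of_le (S₂ :=
    Submodule.span ℂ (χ '' (Finset.range N : Set ℕ))) ?_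
  rintro _ ⟨f, rfl⟩
  simp only [intervalOp, ContinuousLinearMap.coe_coe, sum_apply]
  refine Submodule.sum_mem _ fun j hj => ?_
  exact Submodule.smul_mem _ _ (Submodule.smul_mem _ _
    (Submodule.subset_span ⟨j, hj, rfl⟩))

lemma re_inner_intervalOp (M : ℝ) {a : ℕ → ℝ} (ha : Monotone a) (N : ℕ) (φ : 𝓢(ℝ, ℂ)) :
    (inner ℂ (intervalOp M a N (φ.toLp 2 volume)) (φ.toLp 2 volume : L2)).re
      = M * ∑ j ∈ Finset.range N, ‖∫ x in a j..a (j + 1), φ x‖ ^ 2 := by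
  simp only [intervalOp, sum_apply, sum_inner, Complex.re_sum, Finset.mul_sum]
  refine Finset.sum_congr rfl fun j _ => ?_
  set χ : L2 := indicatorConstLp 2
    (measurableSet_Ioc (a := a j) (b := a (j + 1))) measure_Ioc_lt_top.ne (1 : ℂ) with hχ
  have e : inner ℂ χ (φ.toLp 2 volume : L2) = ∫ x in a j..a (j + 1), φ x := by
    rw [hχ, L2.inner_indicatorConstLp_one, intervalIntegral.integral_of_le (ha (Nat.le_succ j))]
    refine setIntegral_congr_ae measurableSet_Ioc ?_
    filter_upwards [φ.coeFn_toLp 2 volume] with x hx _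
    exact hx
  simp only [smul_apply, ContinuousLinearMap.smulRight_apply, innerSL_apply_apply,
    inner_smul_left, e, Complex.conj_ofReal, Complex.re_ofReal_mul]
  rw [Complex.conj_mul', ← Complex.ofReal_pow, Complex.ofReal_re]

/-- A Schrödinger operator whose potential is at least `δ` outside of a bounded set is at least `δ`
up to a finite-rank perturbation. -/
theorem exists_finiteRank_form_bound {V : ℝ → ℝ} (hV : IsBddPotential V) {δ R : ℝ} (hδ : 0 < δ)
    (hR : 0 < R) (hVR : ∀ x, R ≤ |x| → δ ≤ V x) :
    ∃ K : L2 →L[ℂ] L2, FiniteDimensional ℂ K.range ∧ ∀ f : (schrodinger V).domain,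
      δ * ‖(f : L2)‖ ^ 2 ≤ (inner ℂ (schrodinger V f + K f) (f : L2)).re := by
  obtain ⟨C, hC⟩ := hV.bounded
  have hC0 : 0 ≤ C := (abs_nonneg _).trans (hC 0)
  -- `m` bounds the deficit `δ - V` on `[-R, R]`.
  set m := δ + C with hm
  have hm0 : 0 < m := by positivity
  -- With `ℓ = 2R / N` the smallness condition `2 ℓ² m ≤ 1` reads `8 R² m ≤ N²`; the summand `1`
  -- gives `N > 1`, hence `N ≤ N²`.
  obtain ⟨N, hN⟩ := exists_nat_gt (8 * R ^ 2 * m + 1)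
  have hN1 : (1 : ℝ) < N := lt_of_le_of_lt (by nlinarith [mul_nonneg (sq_nonneg R) hm0.le]) hN
  have hN0 : (0 : ℝ) < N := by linarith
  set ℓ : ℝ := 2 * R / N with hℓ
  have hℓ0 : 0 < ℓ := by positivity
  have hℓm : 2 * ℓ ^ 2 * m ≤ 1 := by
    have : 2 * ℓ ^ 2 * m = 8 * R ^ 2 * m / N ^ 2 := by rw [hℓ]; field_simp; ring
    rw [this, div_le_one (by positivity)]
    nlinarith
  set a : ℕ → ℝ := fun j => -R + j * ℓ with ha
  have hstep : ∀ j, a (j + 1) - a j = ℓ := fun j => by simp only [ha]; push_cast; ring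
  have hlt : ∀ j, a j < a (j + 1) := fun j => by linarith [hstep j]
  have hmono : Monotone a := monotone_nat_of_le_succ fun j => (hlt j).le
  have ha0 : a 0 = -R := by simp [ha]
  have haN : a N = R := by simp only [ha, hℓ]; field_simp; ring
  set M := 2 * m / ℓ with hM
  refine ⟨intervalOp M a N, finiteDimensional_range_intervalOp M a N,
    re_inner_ge_of_schwartz hV fun φ => ?_⟩
  rw [re_inner_intervalOp M hmono, integral_formDensity_schwartz hV]
  set d : 𝓢(ℝ, ℂ) := ∂_{(1 : ℝ)} φ with hd
  have hsq : ∀ φ : 𝓢(ℝ, ℂ), Integrable fun x => ‖φ x‖ ^ 2 :=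
    fun φ => (φ.memLp 2).integrable_norm_pow two_ne_zero
  have i3 : Integrable fun x => V x * ‖φ x‖ ^ 2 :=
    (hsq φ).bdd_mul hV.continuous.aestronglyMeasurable (c := C) (Eventually.of_forall hC)
  have i4 : Integrable fun x => ‖d x‖ ^ 2 + V x * ‖φ x‖ ^ 2 := (hsq d).add i3
  have iG : Integrable fun x => ‖d x‖ ^ 2 + V x * ‖φ x‖ ^ 2 - δ * ‖φ x‖ ^ 2 :=
    i4.sub ((hsq φ).const_mul δ)
  have iL : ∀ s t : ℝ, IntervalIntegrable (fun x => ‖d x‖ ^ 2) volume s t := fun s t =>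
    (hsq d).intervalIntegrable
  have iP : ∀ s t : ℝ, IntervalIntegrable (fun x => m * ‖φ x‖ ^ 2) volume s t := fun s t =>
    ((hsq φ).const_mul m).intervalIntegrable
  have hloc : ∀ j, -(M * ‖∫ x in a j..a (j + 1), φ x‖ ^ 2) ≤
      ∫ x in a j..a (j + 1), (‖d x‖ ^ 2 - m * ‖φ x‖ ^ 2) := by
    intro j
    have h := poincare_interval_weighted (schwartz_hasDerivAt φ) d.continuous hm0.le (hlt j)
      (by rw [hstep]; exact hℓm)
    rw [hstep] at h
    rw [intervalIntegral.integral_sub (iL _ _) (iP _ _), intervalIntegral.integral_const_mul]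
    linarith
  have hsum : -(M * ∑ j ∈ Finset.range N, ‖∫ x in a j..a (j + 1), φ x‖ ^ 2) ≤
      ∫ x in (-R)..R, (‖d x‖ ^ 2 - m * ‖φ x‖ ^ 2) := by
    rw [← ha0]
    conv_rhs => rw [← haN]
    rw [← intervalIntegral.sum_integral_adjacent_intervals
      (fun k _ => (iL _ _).sub (iP _ _)), Finset.mul_sum, ← Finset.sum_neg_distrib]
    exact Finset.sum_le_sum fun j _ => hloc j
  have hin : ∫ x in (-R)..R, (‖d x‖ ^ 2 - m * ‖φ x‖ ^ 2) ≤
      ∫ x in Set.Ioc (-R) R, (‖d x‖ ^ 2 + V x * ‖φ x‖ ^ 2 - δ * ‖φ x‖ ^ 2) := by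
    rw [intervalIntegral.integral_of_le (by linarith)]
    refine integral_mono (((hsq d).sub ((hsq φ).const_mul m)).integrableOn) iG.integrableOn
      fun x => ?_
    have := (abs_le.1 (hC x)).1
    simp only [hm]
    nlinarith [sq_nonneg ‖φ x‖]
  have hout : 0 ≤ ∫ x in (Set.Ioc (-R) R)ᶜ,
      (‖d x‖ ^ 2 + V x * ‖φ x‖ ^ 2 - δ * ‖φ x‖ ^ 2) := by
    refine setIntegral_nonneg measurableSet_Ioc.compl fun x hx => ?_
    have : R ≤ |x| := by
      by_contra! hcon
      exact hx ⟨(abs_lt.1 hcon).1, (abs_lt.1 hcon).2.le⟩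
    nlinarith [hVR x this, sq_nonneg ‖φ x‖, sq_nonneg ‖d x‖]
  have htot := integral_add_compl (measurableSet_Ioc (a := -R) (b := R)) iG
  rw [integral_sub i4 ((hsq φ).const_mul δ), integral_const_mul] at htot
  linarith

end Poincare

/-! ### Soliton profiles -/

section Profile

open Filter Topology

/-- A continuous function that is `O((1 + x²)⁻¹)`. -/
structure IsDecaying (g : ℝ → ℝ) : Prop where
  continuous : Continuous g
  bound : ∃ C, ∀ x, |g x| ≤ C * (1 + x ^ 2)⁻¹

namespace IsDecaying

variable {g b : ℝ → ℝ}

lemma mul_left (hg : IsDecaying g) (hb : IsBddPotential b) : IsDecaying fun x => b x * g x := by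
  obtain ⟨C, hC⟩ := hg.bound
  obtain ⟨B, hB⟩ := hb.bounded
  refine ⟨hb.continuous.mul hg.continuous, B * C, fun x => ?_⟩
  rw [abs_mul, mul_assoc]
  exact mul_le_mul (hB x) (hC x) (abs_nonneg _) ((abs_nonneg _).trans (hB x))

lemma of_abs_le (hg : IsDecaying g) (hb : Continuous b) {C : ℝ} (hC : 0 ≤ C)
    (h : ∀ x, |b x| ≤ C * |g x|) : IsDecaying b := by
  obtain ⟨B, hB⟩ := hg.bound
  refine ⟨hb, C * B, fun x => (h x).trans ?_⟩
  rw [mul_assoc]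
  exact mul_le_mul_of_nonneg_left (hB x) hC

lemma isBddPotential (hg : IsDecaying g) : IsBddPotential g := by
  obtain ⟨C, hC⟩ := hg.bound
  have hC0 : 0 ≤ C := by simpa using (abs_nonneg _).trans (hC 0)
  refine ⟨hg.continuous, C, fun x => (hC x).trans (mul_le_of_le_one_right hC0 ?_)⟩
  exact inv_le_one_of_one_le₀ (by nlinarith [sq_nonneg x])

lemma integrable (hg : IsDecaying g) : Integrable g := by
  obtain ⟨C, hC⟩ := hg.bound
  exact (integrable_inv_one_add_sq.const_mul C).mono' hg.continuous.aestronglyMeasurable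
    (Eventually.of_forall hC)

lemma memLp (hg : IsDecaying g) : MemLp (fun x => (g x : ℂ)) 2 volume := by
  refine MemLp.ofReal ((memLp_two_iff_integrable_sq hg.continuous.aestronglyMeasurable).2 ?_)
  simpa only [sq] using (hg.mul_left hg.isBddPotential).integrable

lemma tendsto (hg : IsDecaying g) : Tendsto g (cocompact ℝ) (𝓝 0) := by
  obtain ⟨C, hC⟩ := hg.bound
  refine squeeze_zero_norm hC ?_
  have h1 : Tendsto (fun x : ℝ => 1 + x ^ 2) (cocompact ℝ) atTop := by
    refine tendsto_atTop_add_const_left _ _ ?_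
    have := (tendsto_pow_atTop (α := ℝ) two_ne_zero).comp (tendsto_norm_cocompact_atTop (E := ℝ))
    simpa [Function.comp_def] using this
  simpa using h1.inv_tendsto_atTop.const_mul C

end IsDecaying

namespace IsBddPotential

variable {V W : ℝ → ℝ}

lemma const (c : ℝ) : IsBddPotential fun _ => c := ⟨continuous_const, |c|, fun _ => le_rfl⟩

lemma add (hV : IsBddPotential V) (hW : IsBddPotential W) : IsBddPotential fun x => V x + W x := by
  obtain ⟨C, hC⟩ := hV.bounded
  obtain ⟨D, hD⟩ := hW.bounded
  exact ⟨hV.continuous.add hW.continuous, C + D,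
    fun x => (abs_add_le _ _).trans (add_le_add (hC x) (hD x))⟩

lemma mul (hV : IsBddPotential V) (hW : IsBddPotential W) : IsBddPotential fun x => V x * W x := by
  obtain ⟨C, hC⟩ := hV.bounded
  obtain ⟨D, hD⟩ := hW.bounded
  refine ⟨hV.continuous.mul hW.continuous, C * D, fun x => ?_⟩
  rw [abs_mul]
  exact mul_le_mul (hC x) (hD x) (abs_nonneg _) ((abs_nonneg _).trans (hC x))

end IsBddPotential

/-- The second derivative of a profile, as a function of the profile. -/
def accel (ψ s y : ℝ) : ℝ := 4 * ψ ^ 2 * (s ^ 2 - 3 * y - 2 * y ^ 2) * y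

/-- The decaying homoclinic profiles `q` with derivative `q₁`, from which the solitons
`ψ (1 + 2 q)` are built. -/
structure IsProfile (ψ s : ℝ) (q q₁ : ℝ → ℝ) : Prop where
  psi_pos : 0 < ψ
  s_pos : 0 < s
  norm_eq : 6 * ψ ^ 2 + 4 * s ^ 2 * ψ ^ 2 = 1
  hasDerivAt : ∀ x, HasDerivAt q (q₁ x) x
  hasDerivAt_deriv : ∀ x, HasDerivAt q₁ (accel ψ s (q x)) x
  energy : ∀ x, q₁ x ^ 2 = 4 * ψ ^ 2 * (s ^ 2 - 2 * q x - q x ^ 2) * q x ^ 2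
  ne_zero : ∀ x, q x ≠ 0
  deriv_zero : q₁ 0 = 0
  deriv_ne_zero : ∀ x ≠ 0, q₁ x ≠ 0
  accel_ne_zero : accel ψ s (q 0) ≠ 0
  decaying : IsDecaying q

namespace IsProfile

variable {ψ s : ℝ} {q q₁ : ℝ → ℝ}

lemma bdd_poly (h : IsProfile ψ s q q₁) (a b c : ℝ) :
    IsBddPotential fun x => a + b * q x + c * q x ^ 2 := by
  have hq := h.decaying.isBddPotential
  simpa only [sq] using ((IsBddPotential.const a).add ((IsBddPotential.const b).mul hq)).add
    ((IsBddPotential.const c).mul (hq.mul hq))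

/-- The energy identity bounds `q₁²` by a constant multiple of `q²`. -/
lemma decaying_deriv (h : IsProfile ψ s q q₁) : IsDecaying q₁ := by
  obtain ⟨C, hC⟩ := h.decaying.isBddPotential.bounded
  have hC0 : 0 ≤ C := (abs_nonneg _).trans (hC 0)
  have hψ := h.psi_pos
  refine h.decaying.of_abs_le (C := 2 * ψ * (s ^ 2 + 2 * C + 1))
    (continuous_iff_continuousAt.2 fun x => (h.hasDerivAt_deriv x).continuousAt) (by positivity)
    fun x => ?_
  rw [← abs_of_nonneg (by positivity : 0 ≤ 2 * ψ * (s ^ 2 + 2 * C + 1)), ← abs_mul]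
  refine sq_le_sq.1 ?_
  rw [h.energy]
  have h1 := (abs_le.1 (hC x)).1
  have h2 : s ^ 2 - 2 * q x - q x ^ 2 ≤ (s ^ 2 + 2 * C + 1) ^ 2 := by
    nlinarith [sq_nonneg (q x), sq_nonneg s, sq_nonneg (s ^ 2 + 2 * C)]
  calc _ ≤ 4 * ψ ^ 2 * (s ^ 2 + 2 * C + 1) ^ 2 * q x ^ 2 := by gcongr
    _ = _ := by ring

lemma decaying_accel (h : IsProfile ψ s q q₁) : IsDecaying fun x => accel ψ s (q x) := by
  have := h.decaying.mul_left
    (h.bdd_poly (4 * ψ ^ 2 * s ^ 2) (-(12 * ψ ^ 2)) (-(8 * ψ ^ 2)))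
  refine (funext fun x => ?_ : (fun x => accel ψ s (q x)) = _) ▸ this
  simp only [accel]; ring

lemma bdd_potential (h : IsProfile ψ s q q₁) (k : ℝ) :
    IsBddPotential fun x => -k * (ψ * (1 + 2 * q x)) ^ 2 + 1 := by
  have := h.bdd_poly (1 - k * ψ ^ 2) (-(4 * k * ψ ^ 2)) (-(4 * k * ψ ^ 2))
  refine (funext fun x => ?_ : (fun x => -k * (ψ * (1 + 2 * q x)) ^ 2 + 1) = _) ▸ this
  ring

/-- This is the differentiated soliton equation: by `norm_eq`, `q₁` solves `p'' = V p` with `V` the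
potential of `𝓛₊`. It yields both the kernel and the comparison function. -/
lemma hasDerivAt_accel (h : IsProfile ψ s q q₁) (x : ℝ) : HasDerivAt (fun x => accel ψ s (q x))
    ((-6 * (ψ * (1 + 2 * q x)) ^ 2 + 1) * q₁ x) x := by
  have hq := h.hasDerivAt x
  have := (((hq.const_mul 3).const_sub (s ^ 2)).sub ((hq.pow 2).const_mul 2)).const_mul
    (4 * ψ ^ 2) |>.mul hq
  refine this.congr_deriv ?_
  have := h.norm_eq
  simp only [Pi.sub_apply, Pi.pow_apply]
  push_cast
  linear_combination q₁ x * this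

/-- Away from a bounded set, the potentials are bounded below by a positive constant. -/
lemma exists_potential_ge (h : IsProfile ψ s q q₁) {k : ℝ} (hk : k * ψ ^ 2 < 1) :
    ∃ δ > 0, ∃ R > 0, ∀ x, R ≤ |x| → δ ≤ -k * (ψ * (1 + 2 * q x)) ^ 2 + 1 := by
  have hc : Continuous fun y : ℝ => -k * (ψ * (1 + 2 * y)) ^ 2 + 1 := by fun_prop
  have ht := (hc.tendsto 0).comp h.decaying.tendsto
  -- The potential tends to `1 - k ψ²` at infinity; half of this limit serves as `δ`.
  have hlt : (1 - k * ψ ^ 2) / 2 < -k * (ψ * (1 + 2 * 0)) ^ 2 + 1 := by nlinarith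
  have hev := ht.eventually (lt_mem_nhds hlt)
  rw [← Metric.cobounded_eq_cocompact] at hev
  obtain ⟨R, -, hR⟩ := (Metric.hasBasis_cobounded_compl_closedBall (0 : ℝ)).eventually_iff.1 hev
  refine ⟨(1 - k * ψ ^ 2) / 2, by linarith, |R| + 1, by positivity, fun x hx => (hR ?_).le⟩
  rw [Set.mem_compl_iff, mem_closedBall_zero_iff, Real.norm_eq_abs]
  linarith [le_abs_self R]

theorem exists_finiteRank (h : IsProfile ψ s q q₁) {k : ℝ} (hk : k * ψ ^ 2 < 1) :
    ∃ K : L2 →L[ℂ] L2, FiniteDimensional ℂ K.range ∧ ∃ δ > 0,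
      ∀ f : (schrodinger fun x => -k * (ψ * (1 + 2 * q x)) ^ 2 + 1).domain, δ * ‖(f : L2)‖ ^ 2 ≤
        (inner ℂ (schrodinger (fun x => -k * (ψ * (1 + 2 * q x)) ^ 2 + 1) f + K f)
          (f : L2)).re := by
  obtain ⟨δ, hδ, R, hR, hVR⟩ := h.exists_potential_ge hk
  obtain ⟨K, hK, hb⟩ := exists_finiteRank_form_bound (h.bdd_potential k) hδ hR hVR
  exact ⟨K, hK, δ, hδ, hb⟩

/-- By the energy identity the square of the ratio is a function of `q` alone, continuous at `q = 0`
with value `4ψ²s²`, and `q` tends to `0` at infinity. -/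
lemma exists_ratio_bound (h : IsProfile ψ s q q₁) :
    ∃ C, ∀ᶠ x in cocompact ℝ, |accel ψ s (q x) / q₁ x| ≤ C := by
  have hs := h.s_pos
  have hc : ContinuousAt (fun y : ℝ => 4 * ψ ^ 2 * (s ^ 2 - 3 * y - 2 * y ^ 2) ^ 2
      / (s ^ 2 - 2 * y - y ^ 2)) 0 :=
    ContinuousAt.div (by fun_prop) (by fun_prop) (by simp [hs.ne'])
  have ht := hc.tendsto.comp h.decaying.tendsto
  set L := 4 * ψ ^ 2 * (s ^ 2 - 3 * 0 - 2 * 0 ^ 2) ^ 2 / (s ^ 2 - 2 * 0 - 0 ^ 2) with hL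
  have hev := ht.eventually (gt_mem_nhds (lt_add_one L))
  refine ⟨L + 2, ?_⟩
  have hne : ∀ᶠ x in cocompact ℝ, x ≠ 0 := isCompact_singleton.compl_mem_cocompact (s := {(0 : ℝ)})
  filter_upwards [hev, hne] with x hx hx0
  have h1 := h.deriv_ne_zero x hx0
  have h2 := h.ne_zero x
  have hψ := h.psi_pos.ne'
  have he := h.energy x
  have h3 : s ^ 2 - 2 * q x - q x ^ 2 ≠ 0 := by
    intro h0
    rw [h0, mul_zero, zero_mul] at he
    exact h1 (pow_eq_zero_iff two_ne_zero |>.1 he)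
  have e : (accel ψ s (q x) / q₁ x) ^ 2 = 4 * ψ ^ 2 * (s ^ 2 - 3 * q x - 2 * q x ^ 2) ^ 2
      / (s ^ 2 - 2 * q x - q x ^ 2) := by
    rw [div_pow, he, accel]
    field_simp
  have h4 : (accel ψ s (q x) / q₁ x) ^ 2 < L + 1 := by rw [e]; exact hx
  rw [← sq_abs] at h4
  nlinarith [sq_nonneg (|accel ψ s (q x) / q₁ x| - 1), abs_nonneg (accel ψ s (q x) / q₁ x)]

/-- The form of `𝓛₊` is nonnegative on a nontrivial combination of any two vectors. -/
theorem exists_combination_nonneg_LPlus (h : IsProfile ψ s q q₁)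
    (f g : (schrodinger fun x => -6 * (ψ * (1 + 2 * q x)) ^ 2 + 1).domain) :
    ∃ a b : ℂ, (a ≠ 0 ∨ b ≠ 0) ∧
      0 ≤ (inner ℂ (schrodinger (fun x => -6 * (ψ * (1 + 2 * q x)) ^ 2 + 1) (a • f + b • g))
        ((a • f + b • g : (schrodinger _).domain) : L2)).re := by
  obtain ⟨C, hC⟩ := h.exists_ratio_bound
  refine exists_combination_nonneg (h.bdd_potential 6) (fun φ hφ => ?_) f g
  exact integral_nonneg_of_apply_zero (h.bdd_potential 6) h.hasDerivAt_deriv h.hasDerivAt_accel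
    h.deriv_ne_zero h.deriv_zero h.accel_ne_zero ⟨C, hC.filter_mono atTop_le_cocompact⟩
    ⟨C, hC.filter_mono atBot_le_cocompact⟩ hφ

/-- The derivative of the soliton is in the kernel of `𝓛₊`. -/
theorem exists_kernel_LPlus (h : IsProfile ψ s q q₁) :
    ∃ v : (schrodinger fun x => -6 * (ψ * (1 + 2 * q x)) ^ 2 + 1).domain,
      ((v : L2) : ℝ → ℂ) =ᵐ[volume] (fun x => ((ψ * (2 * q₁ x) : ℝ) : ℂ)) ∧
      schrodinger _ v = 0 := by
  have hV := h.bdd_potential 6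
  have d1 : ∀ x, HasDerivAt (fun x => ((ψ * (2 * q₁ x) : ℝ) : ℂ))
      ((2 * ψ * accel ψ s (q x) : ℝ) : ℂ) x := fun x =>
    ((((h.hasDerivAt_deriv x).const_mul 2).const_mul ψ).congr_deriv (by ring)).ofReal_comp
  have d2 : ∀ x, HasDerivAt (fun x => ((2 * ψ * accel ψ s (q x) : ℝ) : ℂ))
      ((2 * ψ * ((-6 * (ψ * (1 + 2 * q x)) ^ 2 + 1) * q₁ x) : ℝ) : ℂ) x := fun x =>
    ((h.hasDerivAt_accel x).const_mul (2 * ψ)).ofReal_comp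
  have m0 : MemLp (fun x => ((ψ * (2 * q₁ x) : ℝ) : ℂ)) 2 volume :=
    ((h.decaying_deriv.mul_left (.const 2)).mul_left (.const ψ)).memLp
  have m1 : MemLp (fun x => ((2 * ψ * accel ψ s (q x) : ℝ) : ℂ)) 2 volume :=
    (h.decaying_accel.mul_left (.const (2 * ψ))).memLp
  have m2 : MemLp (fun x => ((2 * ψ * ((-6 * (ψ * (1 + 2 * q x)) ^ 2 + 1) * q₁ x) : ℝ) : ℂ)) 2
      volume := ((h.decaying_deriv.mul_left hV).mul_left (.const (2 * ψ))).memLp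
  obtain ⟨hf, e⟩ := exists_domain_of_hasDerivAt hV d1 d2 m0 m1 m2
  refine ⟨⟨_, hf⟩, m0.coeFn_toLp, ?_⟩
  rw [e, Lp.eq_zero_iff_ae_eq_zero]
  refine (MemLp.coeFn_toLp _).trans (Eventually.of_forall fun x => ?_)
  simp only [Pi.add_apply, Pi.neg_apply, Pi.zero_apply]
  push_cast
  ring

theorem isEigenvalue_zero_LPlus (h : IsProfile ψ s q q₁) :
    IsEigenvalue (schrodinger fun x => -6 * (ψ * (1 + 2 * q x)) ^ 2 + 1) 0 := by
  obtain ⟨v, hv, hv0⟩ := h.exists_kernel_LPlus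
  refine isEigenvalue_iff.2 ⟨v, fun h0 => ?_, by rw [hv0, zero_smul]⟩
  have h1 : (fun x => ((ψ * (2 * q₁ x) : ℝ) : ℂ)) =ᵐ[volume] fun _ => (0 : ℂ) := by
    refine hv.symm.trans ?_
    rw [h0]
    exact Lp.coeFn_zero ℂ 2 volume
  have hc : Continuous fun x => ((ψ * (2 * q₁ x) : ℝ) : ℂ) :=
    Complex.continuous_ofReal.comp
      (continuous_const.mul (continuous_const.mul h.decaying_deriv.continuous))
  have h2 := congrFun ((hc.ae_eq_iff_eq volume continuous_const).1 h1) 1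
  have h3 := h.deriv_ne_zero 1 one_ne_zero
  have h4 := h.psi_pos.ne'
  simp [h3, h4] at h2

/-- If the form density on the profile is, up to a total derivative, negative, then the form takes
a negative value. -/
lemma exists_neg_form (h : IsProfile ψ s q q₁) {k : ℝ} {F F' : ℝ → ℝ}
    (hF : ∀ x, HasDerivAt F (F' x) x)
    (iF : Integrable F) (iF' : Integrable F')
    (hneg : ∀ x, (-k * (ψ * (1 + 2 * q x)) ^ 2 + 1) * q x ^ 2 - accel ψ s (q x) * q x + F' x < 0) :
    ∃ f : (schrodinger fun x => -k * (ψ * (1 + 2 * q x)) ^ 2 + 1).domain,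
      (inner ℂ (schrodinger _ f) (f : L2)).re < 0 := by
  have hV := h.bdd_potential k
  have m0 := h.decaying.memLp
  have m2 := h.decaying_accel.memLp
  obtain ⟨hf, e⟩ := exists_domain_of_hasDerivAt hV (fun x => (h.hasDerivAt x).ofReal_comp)
    (fun x => (h.hasDerivAt_deriv x).ofReal_comp) m0 h.decaying_deriv.memLp m2
  refine ⟨⟨_, hf⟩, ?_⟩
  rw [e, re_inner_eq_integral hV m0 m2]
  have iD := integrable_formDensity hV m0 m2
  have hz := integral_eq_zero_of_hasDerivAt_of_integrable hF iF' iF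
  have hd : ∀ x, formDensity (fun x => -k * (ψ * (1 + 2 * q x)) ^ 2 + 1) (fun x => (q x : ℂ))
      (fun x => (accel ψ s (q x) : ℂ)) x
      = (-k * (ψ * (1 + 2 * q x)) ^ 2 + 1) * q x ^ 2 - accel ψ s (q x) * q x := fun x => by
    simp only [formDensity, Complex.conj_ofReal, ← Complex.ofReal_mul, Complex.ofReal_re,
      Complex.norm_real, Real.norm_eq_abs, sq_abs]
    ring
  have hlt : ∀ x, 0 < -(formDensity (fun x => -k * (ψ * (1 + 2 * q x)) ^ 2 + 1)
      (fun x => (q x : ℂ)) (fun x => (accel ψ s (q x) : ℂ)) x + F' x) := fun x => by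
    rw [hd]; linarith [hneg x]
  have hpos := (integral_pos_iff_support_of_nonneg (fun x => (hlt x).le) (iD.add iF').neg).2 (by
    have : Function.support (fun x => -(formDensity (fun x => -k * (ψ * (1 + 2 * q x)) ^ 2 + 1)
      (fun x => (q x : ℂ)) (fun x => (accel ψ s (q x) : ℂ)) x + F' x)) = Set.univ :=
      Set.eq_univ_of_forall fun x => (hlt x).ne'
    rw [this]
    simp)
  rw [integral_neg, integral_add iD iF', hz] at hpos
  linarith

/-- The test function is `q`. Adding the derivative of `-(3/5) q q₁` removes the term in `q³`, whose
sign depends on the soliton; the rest is negative in both cases. -/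
theorem exists_neg_form_LPlus (h : IsProfile ψ s q q₁) :
    ∃ f : (schrodinger fun x => -6 * (ψ * (1 + 2 * q x)) ^ 2 + 1).domain,
      (inner ℂ (schrodinger _ f) (f : L2)).re < 0 := by
  have hψ := h.psi_pos
  have hs := h.s_pos
  have i1 : Integrable fun x => -(3 / 5) * (q x * q₁ x) :=
    ((h.decaying_deriv.mul_left h.decaying.isBddPotential).mul_left (.const (-(3 / 5)))).integrable
  have i2 : Integrable fun x => -(3 / 5) * (q₁ x * q₁ x + q x * accel ψ s (q x)) :=
    ((h.decaying_deriv.mul_left h.decaying_deriv.isBddPotential).integrable.add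
      (h.decaying_accel.mul_left h.decaying.isBddPotential).integrable).const_mul _
  refine h.exists_neg_form (fun x => ((h.hasDerivAt x).mul (h.hasDerivAt_deriv x)).const_mul _)
    i1 i2 fun x => ?_
  have he := h.energy x
  have hn := h.norm_eq
  have hq : 0 < q x ^ 2 := by have := h.ne_zero x; positivity
  have e : (-6 * (ψ * (1 + 2 * q x)) ^ 2 + 1) * q x ^ 2 - accel ψ s (q x) * q x
      + -(3 / 5) * (q₁ x * q₁ x + q x * accel ψ s (q x))
      = -(4 * ψ ^ 2 * q x ^ 2 * (6 / 5 * s ^ 2 + 11 / 5 * q x ^ 2)) := by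
    rw [accel]
    linear_combination -(3 / 5) * he - q x ^ 2 * hn
  rw [e]
  have : 0 < 4 * ψ ^ 2 * q x ^ 2 * (6 / 5 * s ^ 2 + 11 / 5 * q x ^ 2) := by positivity
  linarith

/-- Again tested on `q`: the total derivative of `q₁ / 2` cancels the cubic term and leaves `2ψ²(s²
q - q²)`, negative because `q < 0`. -/
theorem exists_neg_form_LMinus (h : IsProfile ψ s q q₁) (hneg : ∀ x, q x < 0) :
    ∃ f : (schrodinger fun x => -2 * (ψ * (1 + 2 * q x)) ^ 2 + 1).domain,
      (inner ℂ (schrodinger _ f) (f : L2)).re < 0 := by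
  have hψ := h.psi_pos
  have hs := h.s_pos
  refine h.exists_neg_form (fun x => (h.hasDerivAt_deriv x).const_mul (1 / 2))
    (h.decaying_deriv.integrable.const_mul _) (h.decaying_accel.integrable.const_mul _) fun x => ?_
  have hn := h.norm_eq
  have e : (-2 * (ψ * (1 + 2 * q x)) ^ 2 + 1) * q x ^ 2 - accel ψ s (q x) * q x
      + 1 / 2 * accel ψ s (q x) = 2 * ψ ^ 2 * (s ^ 2 * q x - q x ^ 2) := by
    rw [accel]
    linear_combination -(q x ^ 2) * hn
  rw [e]
  have h1 : s ^ 2 * q x - q x ^ 2 < 0 := by nlinarith [hneg x, sq_nonneg (q x), pow_pos hs 2]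
  have : 0 < 2 * ψ ^ 2 := by positivity
  nlinarith

/-- `𝓛₋` is positive on a positive soliton. -/
theorem isPositiveOp_LMinus (h : IsProfile ψ s q q₁) (hpos : ∀ x, 0 < q x) :
    IsPositiveOp (schrodinger fun x => -2 * (ψ * (1 + 2 * q x)) ^ 2 + 1) := by
  have hψ := h.psi_pos
  have hs := h.s_pos
  obtain ⟨B, hB⟩ := h.decaying.isBddPotential.bounded
  have hB0 : 0 < 1 + 2 * B := by linarith [(abs_nonneg _).trans (hB 0)]
  have hu : ∀ x, 0 < 1 + 2 * q x := fun x => by linarith [hpos x]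
  have hinv : IsBddPotential fun x => (1 + 2 * q x)⁻¹ := by
    refine ⟨(continuous_const.add (continuous_const.mul h.decaying.continuous)).inv₀
      fun x => (hu x).ne', 1, fun x => ?_⟩
    rw [abs_of_pos (inv_pos.2 (hu x))]
    exact inv_le_one_of_one_le₀ (by linarith [hpos x])
  have hW : IsBddPotential fun x => 2 * accel ψ s (q x) * (1 + 2 * q x)⁻¹ :=
    ((IsBddPotential.const 2).mul h.decaying_accel.isBddPotential).mul hinv
  set κ : ℝ := 4 * ψ ^ 2 * (1 + s ^ 2) / (1 + 2 * B) with hκ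
  have hκ0 : 0 < κ := by positivity
  intro f hf
  -- The comparison function is `u / ψ`, with `W = u'' / u`. Since `-u'' - 2u³ + u` is the positive
  -- constant `4ψ³(1 + s²)`, the difference `V - W` is this constant divided by `u`, and `q ≤ B`
  -- bounds it below by `κ`.
  have key := re_inner_ge_of_pos_solution (h.bdd_potential 2) hW (κ := κ)
    (p := fun x => 1 + 2 * q x) (p' := fun x => 2 * q₁ x) (fun x => ?_)
    (fun x => ((h.hasDerivAt x).const_mul 2).const_add 1)
    (fun x => ((h.hasDerivAt_deriv x).const_mul 2).congr_deriv (by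
      have := (hu x).ne'
      field_simp)) (fun x => (hu x).ne') ?_ f
  · have : 0 < ‖(f : L2)‖ := norm_pos_iff.2 fun h0 => hf (Subtype.ext h0)
    exact lt_of_lt_of_le (by positivity) key
  · have hne := (hu x).ne'
    have e : -2 * (ψ * (1 + 2 * q x)) ^ 2 + 1 - 2 * accel ψ s (q x) * (1 + 2 * q x)⁻¹
        = 4 * ψ ^ 2 * (1 + s ^ 2) / (1 + 2 * q x) := by
      rw [eq_div_iff hne, sub_mul, mul_assoc, inv_mul_cancel₀ hne, accel]
      linear_combination -(1 + 2 * q x) * h.norm_eq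
    rw [e, hκ]
    have := hu x
    have := (le_abs_self _).trans (hB x)
    gcongr
  · obtain ⟨C, hC⟩ := (((IsBddPotential.const 2).mul h.decaying_deriv.isBddPotential).mul
      hinv).bounded
    exact ⟨C, fun x => by rw [div_eq_mul_inv]; exact hC x⟩

end IsProfile

end Profile

section Soliton

open Filter Topology

/-! ### Comparison of two potentials -/

lemma re_inner_mulOp {V : ℝ → ℝ} (f : mulDomain V) :
    (inner ℂ (mulOp V f) (f : L2)).re = ∫ x, V x * ‖(f : L2) x‖ ^ 2 := by
  rw [L2.inner_def]
  refine (integral_re (L2.integrable_inner (𝕜 := ℂ) (mulOp V f) (f : L2))).symm.trans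
    (integral_congr_ae ?_)
  filter_upwards [coeFn_mulOp f] with x hx
  rw [hx, RCLike.inner_apply, map_mul
    (starRingEnd ℂ), Complex.conj_ofReal, mul_left_comm, Complex.mul_conj',
    ← Complex.ofReal_pow, ← Complex.ofReal_mul]
  exact Complex.ofReal_re _

/-- A form that is nonnegative at `f ≠ 0` becomes positive when the potential is increased almost
everywhere. -/
lemma re_inner_pos_of_lt {V W : ℝ → ℝ} (hV : IsBddPotential V) (hW : IsBddPotential W)
    (hlt : ∀ᵐ x, V x < W x) {f : L2} (hfV : f ∈ (schrodinger V).domain)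
    (hfW : f ∈ (schrodinger W).domain) (hf : f ≠ 0)
    (h : 0 ≤ (inner ℂ (schrodinger V ⟨f, hfV⟩) f).re) :
    0 < (inner ℂ (schrodinger W ⟨f, hfW⟩) f).re := by
  have hsq : Integrable fun x => ‖f x‖ ^ 2 := (Lp.memLp f).integrable_norm_pow two_ne_zero
  have h_int : ∀ {U : ℝ → ℝ}, IsBddPotential U → Integrable fun x => U x * ‖f x‖ ^ 2 := by
    intro U hU
    obtain ⟨C, hC⟩ := hU.bounded
    exact hsq.bdd_mul hU.continuous.aestronglyMeasurable (c := C) (Eventually.of_forall hC)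
  have eV : (inner ℂ (mulOp V ⟨f, hfV.2⟩) f).re = ∫ x, V x * ‖f x‖ ^ 2 :=
    re_inner_mulOp ⟨f, hfV.2⟩
  have eW : (inner ℂ (mulOp W ⟨f, hfW.2⟩) f).re = ∫ x, W x * ‖f x‖ ^ 2 :=
    re_inner_mulOp ⟨f, hfW.2⟩
  rw [schrodinger_apply, inner_add_left, Complex.add_re, eV] at h
  rw [schrodinger_apply, inner_add_left, Complex.add_re, eW]
  have hnn : 0 ≤ᵐ[volume] fun x => W x * ‖f x‖ ^ 2 - V x * ‖f x‖ ^ 2 := by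
    filter_upwards [hlt] with x hx
    have := mul_le_mul_of_nonneg_right hx.le (sq_nonneg ‖f x‖)
    simpa using this
  have hpos : 0 < ∫ x, (W x * ‖f x‖ ^ 2 - V x * ‖f x‖ ^ 2) := by
    refine lt_of_le_of_ne (integral_nonneg_of_ae hnn) fun h0 => hf ?_
    have h1 := (integral_eq_zero_iff_of_nonneg_ae hnn ((h_int hW).sub (h_int hV))).1 h0.symm
    rw [Lp.eq_zero_iff_ae_eq_zero]
    filter_upwards [h1, hlt] with x hx hx'
    simp only [Pi.zero_apply] at hx ⊢
    have h2 : (W x - V x) * ‖f x‖ ^ 2 = 0 := by linarith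
    rcases mul_eq_zero.1 h2 with h3 | h3
    · linarith
    · exact norm_eq_zero.1 (pow_eq_zero_iff two_ne_zero |>.1 h3)
  rw [integral_sub (h_int hW) (h_int hV)] at hpos
  linarith

/-! ### Spectral conclusions for a general profile -/

namespace IsProfile

variable {ψ s : ℝ} {q q₁ : ℝ → ℝ}

/-- Rolle's theorem: `q₁` vanishes only at the origin. -/
lemma injOn (h : IsProfile ψ s q q₁) {I : Set ℝ} (hI : I.OrdConnected) (h0 : (0 : ℝ) ∉ I) :
    Set.InjOn q I := by
  have key : ∀ x ∈ I, ∀ y ∈ I, x < y → q x ≠ q y := by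
    intro x hx y hy hxy he
    obtain ⟨z, hz, hz0⟩ := exists_hasDerivAt_eq_zero hxy h.decaying.continuous.continuousOn he
      fun t _ => h.hasDerivAt t
    exact h.deriv_ne_zero z (fun hz' => h0 (hz' ▸ hI.out hx hy ⟨hz.1.le, hz.2.le⟩)) hz0
  intro x hx y hy he
  rcases lt_trichotomy x y with hxy | hxy | hxy
  · exact absurd he (key x hx y hy hxy)
  · exact hxy
  · exact absurd he.symm (key y hy x hx hxy)

/-- The soliton may change sign, but injectivity of `q` on each half-line leaves finitely many
zeros. -/
lemma ae_soliton_ne_zero (h : IsProfile ψ s q q₁) : ∀ᵐ x, ψ * (1 + 2 * q x) ≠ 0 := by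
  have hsub : ∀ I : Set ℝ, I.OrdConnected → (0 : ℝ) ∉ I → {x ∈ I | q x = -1 / 2}.Finite :=
    fun I hI h0 => Set.Subsingleton.finite fun x hx y hy =>
      h.injOn hI h0 hx.1 hy.1 (hx.2.trans hy.2.symm)
  have hfin : {x | q x = -1 / 2}.Finite := by
    refine ((hsub (Set.Ioi 0) Set.ordConnected_Ioi (by simp)).union
      ((hsub (Set.Iio 0) Set.ordConnected_Iio (by simp)).union (Set.finite_singleton 0))).subset ?_
    intro x hx
    rcases lt_trichotomy x 0 with h0 | h0 | h0
    · exact Or.inr (Or.inl ⟨h0, hx⟩)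
    · exact Or.inr (Or.inr h0)
    · exact Or.inl ⟨h0, hx⟩
  filter_upwards [measure_eq_zero_iff_ae_notMem.1 (hfin.measure_zero volume)] with x hx h0
  refine hx ?_
  have := (mul_eq_zero.1 h0).resolve_left h.psi_pos.ne'
  change q x = -1 / 2
  linarith

/-- The potential of `𝓛₋` exceeds that of `𝓛₊` by `4u²`, positive almost everywhere, so the
nonnegative combination for `𝓛₊` becomes a positive one unless it vanishes. -/
theorem exists_combination_pos_LMinus (h : IsProfile ψ s q q₁)
    (f g : (schrodinger fun x => -2 * (ψ * (1 + 2 * q x)) ^ 2 + 1).domain) :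
    ∃ a b : ℂ, (a ≠ 0 ∨ b ≠ 0) ∧ (a • f + b • g ≠ 0 →
      0 < (inner ℂ (schrodinger (fun x => -2 * (ψ * (1 + 2 * q x)) ^ 2 + 1) (a • f + b • g))
        ((a • f + b • g : (schrodinger _).domain) : L2)).re) := by
  have hdom : (schrodinger fun x => -2 * (ψ * (1 + 2 * q x)) ^ 2 + 1).domain
      = (schrodinger fun x => -6 * (ψ * (1 + 2 * q x)) ^ 2 + 1).domain := by
    rw [domain_schrodinger (h.bdd_potential 2), domain_schrodinger (h.bdd_potential 6)]
  obtain ⟨a, b, hab, hnn⟩ := h.exists_combination_nonneg_LPlus ⟨f, hdom ▸ f.2⟩ ⟨g, hdom ▸ g.2⟩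
  refine ⟨a, b, hab, fun h0 => ?_⟩
  refine re_inner_pos_of_lt (h.bdd_potential 6) (h.bdd_potential 2) ?_ _ (a • f + b • g).2
    (fun h1 => h0 (Subtype.ext h1)) hnn
  filter_upwards [h.ae_soliton_ne_zero] with x hx
  have : 0 < (ψ * (1 + 2 * q x)) ^ 2 := by positivity
  linarith

theorem spectral (h : IsProfile ψ s q q₁) {k : ℝ} (hk : k * ψ ^ 2 < 1) :
    (schrodinger fun x => -k * (ψ * (1 + 2 * q x)) ^ 2 + 1).domain = H2 ∧
    IsSelfAdjoint (schrodinger fun x => -k * (ψ * (1 + 2 * q x)) ^ 2 + 1) ∧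
    essentialSpectrum (schrodinger fun x => -k * (ψ * (1 + 2 * q x)) ^ 2 + 1)
      ⊆ (fun t : ℝ => (t : ℂ)) '' Set.Ioi 0 := by
  obtain ⟨K, hK, δ, hδ, hb⟩ := h.exists_finiteRank hk
  have hsa := isSelfAdjoint_schrodinger (h.bdd_potential k)
  exact ⟨domain_schrodinger (h.bdd_potential k), hsa, essentialSpectrum_subset hsa hδ hb⟩

lemma six_lt (h : IsProfile ψ s q q₁) : 6 * ψ ^ 2 < 1 := by
  have := h.norm_eq
  have hψ := h.psi_pos
  have hs := h.s_pos
  have : 0 < 4 * s ^ 2 * ψ ^ 2 := by positivity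
  linarith

lemma two_lt (h : IsProfile ψ s q q₁) : 2 * ψ ^ 2 < 1 := by
  have := h.six_lt
  nlinarith [sq_nonneg ψ]

theorem zero_mem_pointSpectrum_LPlus (h : IsProfile ψ s q q₁) :
    0 ∈ pointSpectrum (schrodinger fun x => -6 * (ψ * (1 + 2 * q x)) ^ 2 + 1) := by
  obtain ⟨K, hK, δ, hδ, hb⟩ := h.exists_finiteRank h.six_lt
  have he := h.isEigenvalue_zero_LPlus
  rw [← Complex.ofReal_zero] at he ⊢
  exact mem_pointSpectrum (isSelfAdjoint_schrodinger (h.bdd_potential 6)) hδ hb le_rfl he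

theorem morseIndex_LPlus (h : IsProfile ψ s q q₁) :
    morseIndex (schrodinger fun x => -6 * (ψ * (1 + 2 * q x)) ^ 2 + 1) = 1 := by
  obtain ⟨K, hK, δ, hδ, hb⟩ := h.exists_finiteRank h.six_lt
  have hsa := isSelfAdjoint_schrodinger (h.bdd_potential 6)
  obtain ⟨f, hf⟩ := h.exists_neg_form_LPlus
  obtain ⟨t, ht, he⟩ := exists_neg_eigenvalue hsa hδ hb hf
  exact morseIndex_eq_one hsa h.exists_combination_nonneg_LPlus ht he

theorem morseIndex_LMinus (h : IsProfile ψ s q q₁) (hneg : ∀ x, q x < 0) :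
    morseIndex (schrodinger fun x => -2 * (ψ * (1 + 2 * q x)) ^ 2 + 1) = 1 ∧
    ¬ IsEigenvalue (schrodinger fun x => -2 * (ψ * (1 + 2 * q x)) ^ 2 + 1) 0 := by
  obtain ⟨K, hK, δ, hδ, hb⟩ := h.exists_finiteRank h.two_lt
  have hsa := isSelfAdjoint_schrodinger (h.bdd_potential 2)
  obtain ⟨f, hf⟩ := h.exists_neg_form_LMinus hneg
  obtain ⟨t, ht, he⟩ := exists_neg_eigenvalue hsa hδ hb hf
  refine ⟨morseIndex_eq_one hsa (fun f g => ?_) ht he,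
    not_isEigenvalue_zero hsa h.exists_combination_pos_LMinus ht he⟩
  obtain ⟨a, b, hab, hp⟩ := h.exists_combination_pos_LMinus f g
  refine ⟨a, b, hab, ?_⟩
  by_cases h0 : a • f + b • g = 0
  · rw [h0]; simp
  · exact (hp h0).le

end IsProfile

/-! ### The two solitons -/

/-- The profile `q` of the soliton `ψ₀ (1 + 2 q)`. -/
def profile (α ε x : ℝ) : ℝ := sinh α ^ 2 / (1 + ε * cosh α * cosh (rate α * x))

/-- The derivative of the profile. -/
def profileDeriv (α ε x : ℝ) : ℝ :=
  -(sinh α ^ 2 * (ε * cosh α * (sinh (rate α * x) * rate α)))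
    / (1 + ε * cosh α * cosh (rate α * x)) ^ 2

lemma psi0_pos (α : ℝ) : 0 < psi0 α := by unfold psi0; positivity

lemma psi0_sq (α : ℝ) : psi0 α ^ 2 * (2 * (1 + 2 * cosh α ^ 2)) = 1 := by
  have h : 0 < 2 * (1 + 2 * cosh α ^ 2) := by positivity
  rw [psi0, div_pow, Real.sq_sqrt h.le, one_pow, one_div, inv_mul_cancel₀ h.ne']

lemma rate_eq (α : ℝ) : rate α = 2 * sinh α * psi0 α := by
  have h : 0 < 1 + 2 * cosh α ^ 2 := by positivity
  have h1 : 0 < √(1 + 2 * cosh α ^ 2) := Real.sqrt_pos.2 h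
  have h2 : 0 < √(2 : ℝ) := by positivity
  rw [rate, psi0, Real.sqrt_mul (by norm_num)]
  field_simp
  rw [Real.sq_sqrt (by norm_num)]
  ring

/-- From `cosh x = 1 + 2 sinh² (x/2)` and `|sinh y| ≥ |y|`. -/
lemma one_add_sq_div_two_le_cosh (x : ℝ) : 1 + x ^ 2 / 2 ≤ cosh x := by
  have h1 : ∀ y : ℝ, y ^ 2 ≤ sinh y ^ 2 := by
    intro y
    rcases le_total 0 y with hy | hy
    · exact pow_le_pow_left₀ hy (Real.self_le_sinh_iff.2 hy) 2
    · have := pow_le_pow_left₀ (neg_nonneg.2 hy) (Real.self_le_sinh_iff.2 (neg_nonneg.2 hy)) 2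
      rwa [Real.sinh_neg, neg_sq, neg_sq] at this
  have h2 := Real.cosh_two_mul (x / 2)
  rw [mul_div_cancel₀ x two_ne_zero, Real.cosh_sq] at h2
  rw [h2]
  linarith [h1 (x / 2), div_pow x 2 2]

/-- One bound for both signs, since `cosh ≥ 1` absorbs the summand `1`; it gives nonvanishing of the
denominator as well as decay of the profile. -/
lemma abs_denominator_ge {α ε : ℝ} (hα : 0 < α) (hε : ε = 1 ∨ ε = -1) (x : ℝ) :
    (cosh α - 1) * cosh (rate α * x) ≤ |1 + ε * cosh α * cosh (rate α * x)| := by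
  have h1 := Real.one_le_cosh (rate α * x)
  have h2 := Real.one_lt_cosh.2 hα.ne'
  rcases hε with rfl | rfl
  · refine le_trans ?_ (le_abs_self _)
    nlinarith
  · refine le_trans ?_ (neg_le_abs _)
    nlinarith

/-- Both solitons are treated at once: the algebra uses only `ε² = 1`, `cosh² α = sinh² α + 1` and
the relation `rate α = 2 sinh α ψ₀`. -/
theorem isProfile {α ε : ℝ} (hα : 0 < α) (hε : ε = 1 ∨ ε = -1) :
    IsProfile (psi0 α) (sinh α) (profile α ε) (profileDeriv α ε) := by
  have hψ := psi0_pos α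
  have hs : 0 < sinh α := Real.sinh_pos_iff.2 hα
  have hc1 : 1 < cosh α := Real.one_lt_cosh.2 hα.ne'
  have hcs : cosh α ^ 2 = sinh α ^ 2 + 1 := Real.cosh_sq α
  have hA : 0 < rate α := by rw [rate_eq]; positivity
  have hA2 : 4 * psi0 α ^ 2 * sinh α ^ 2 = rate α ^ 2 := by rw [rate_eq]; ring
  have hε2 : ε ^ 2 = 1 := by rcases hε with rfl | rfl <;> norm_num
  have hε0 : ε ≠ 0 := by rcases hε with rfl | rfl <;> norm_num
  have hD : ∀ x, 1 + ε * cosh α * cosh (rate α * x) ≠ 0 := fun x h0 => by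
    have := abs_denominator_ge hα hε x
    rw [h0, abs_zero] at this
    nlinarith [Real.cosh_pos (rate α * x)]
  have hdC : ∀ x, HasDerivAt (fun x => 1 + ε * cosh α * cosh (rate α * x))
      (ε * cosh α * (sinh (rate α * x) * rate α)) x := fun x => by
    have h1 : HasDerivAt (fun x => rate α * x) (rate α) x := by
      simpa using (hasDerivAt_id x).const_mul (rate α)
    exact (h1.cosh.const_mul (ε * cosh α)).const_add 1
  have hdS : ∀ x, HasDerivAt (fun x => sinh (rate α * x)) (cosh (rate α * x) * rate α) x :=
    fun x => by
      have h1 : HasDerivAt (fun x => rate α * x) (rate α) x := by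
        simpa using (hasDerivAt_id x).const_mul (rate α)
      exact h1.sinh
  have hd0 : ∀ x, HasDerivAt (profile α ε) (profileDeriv α ε x) x := fun x => by
    refine ((hasDerivAt_const x (sinh α ^ 2)).div (hdC x) (hD x)).congr_deriv ?_
    rw [profileDeriv]
    congr 1
    ring
  refine ⟨hψ, hs, ?_, hd0, ?_, ?_, ?_, ?_, ?_, ?_, ?_⟩
  · have := psi0_sq α
    rw [hcs] at this
    linarith
  · intro x
    have h1 := ((((hdS x).mul_const (rate α)).const_mul (ε * cosh α)).const_mul
      (sinh α ^ 2)).neg.div ((hdC x).pow 2) (pow_ne_zero 2 (hD x))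
    refine h1.congr_deriv ?_
    have hD' := hD x
    have hSC : sinh (rate α * x) ^ 2 = cosh (rate α * x) ^ 2 - 1 := Real.sinh_sq _
    rw [accel, profile]
    set C := cosh (rate α * x)
    set S := sinh (rate α * x)
    simp only [Pi.pow_apply, Pi.neg_apply]
    -- With the denominator as an atom `D`, both sides are put over `D³`; `D` is expanded again only
    -- to compare numerators.
    generalize hDdef : 1 + ε * cosh α * C = D at hD'
    have e1 : 4 * psi0 α ^ 2 * (sinh α ^ 2 - 3 * (sinh α ^ 2 / D) - 2 * (sinh α ^ 2 / D) ^ 2)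
        * (sinh α ^ 2 / D)
          = rate α ^ 2 * sinh α ^ 2 * (D ^ 2 - 3 * D - 2 * sinh α ^ 2) / D ^ 3 := by
      rw [← hA2]; field_simp
    have e2 : (-(sinh α ^ 2 * (ε * cosh α * (C * rate α * rate α))) * D ^ 2
        - -(sinh α ^ 2 * (ε * cosh α * (S * rate α)))
          * (((2 : ℕ) : ℝ) * D ^ (2 - 1) * (ε * cosh α * (S * rate α)))) / (D ^ 2) ^ 2
        = rate α ^ 2 * sinh α ^ 2 * (-(ε * cosh α) * (C * D - 2 *
          (ε * cosh α) * S ^ 2)) / D ^ 3 := by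
      field_simp
      push_cast
      ring
    rw [e1]
    refine e2.trans ?_
    congr 2
    rw [hSC, ← hDdef]
    linear_combination -2 * cosh α ^ 2 * hε2 - 2 * hcs
  · intro x
    have hD' := hD x
    have hSC : sinh (rate α * x) ^ 2 = cosh (rate α * x) ^ 2 - 1 := Real.sinh_sq _
    rw [profileDeriv, profile]
    set C := cosh (rate α * x)
    set S := sinh (rate α * x)
    generalize hDdef : 1 + ε * cosh α * C = D at hD'
    have e1 : 4 * psi0 α ^ 2 * (sinh α ^ 2 - 2 * (sinh α ^ 2 / D) - (sinh α ^ 2 / D) ^ 2)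
        * (sinh α ^ 2 / D) ^ 2
        = rate α ^ 2 * sinh α ^ 4 * (D ^ 2 - 2 * D - sinh α ^ 2) / D ^ 4 := by
      rw [← hA2]; field_simp
    have e2 : (-(sinh α ^ 2 * (ε * cosh α * (S * rate α))) / D ^ 2) ^ 2
        = rate α ^ 2 * sinh α ^ 4 * ((ε * cosh α) ^ 2 * S ^ 2) / D ^ 4 := by
      field_simp
    rw [e1, e2]
    congr 2
    rw [hSC, ← hDdef]
    linear_combination -(cosh α ^ 2) * hε2 - hcs
  · exact fun x => div_ne_zero (pow_ne_zero 2 hs.ne') (hD x)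
  · simp [profileDeriv]
  · intro x hx
    have hS : sinh (rate α * x) ≠ 0 := fun h0 =>
      (mul_ne_zero hA.ne' hx) (Real.sinh_eq_zero.1 h0)
    refine div_ne_zero (neg_ne_zero.2 ?_) (pow_ne_zero 2 (hD x))
    exact mul_ne_zero (pow_ne_zero 2 hs.ne') (mul_ne_zero (mul_ne_zero hε0 (by linarith))
      (mul_ne_zero hS hA.ne'))
  · have hD0 := hD 0
    rw [mul_zero, Real.cosh_zero, mul_one] at hD0
    -- This uses `sinh² α = (ε cosh α - 1)(ε cosh α + 1)`; the quadratic factor of `accel` also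
    -- factors at this value.
    have hq : profile α ε 0 = ε * cosh α - 1 := by
      rw [profile, mul_zero, Real.cosh_zero, mul_one, div_eq_iff hD0]
      linear_combination -(cosh α ^ 2) * hε2 - hcs
    have hq0 : ε * cosh α - 1 ≠ 0 := fun h0 => by
      have : sinh α ^ 2 = 0 := by linear_combination (ε * cosh α + 1) * h0 - cosh α ^ 2 * hε2 - hcs
      exact hs.ne' (pow_eq_zero_iff two_ne_zero |>.1 this)
    rw [accel, hq]
    have e : sinh α ^ 2 - 3 * (ε * cosh α - 1) - 2 * (ε * cosh α - 1) ^ 2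
        = -(ε * cosh α) * (ε * cosh α - 1) := by
      linear_combination -(cosh α ^ 2) * hε2 - hcs
    rw [e]
    exact mul_ne_zero (mul_ne_zero (by positivity) (mul_ne_zero
      (neg_ne_zero.2 (mul_ne_zero hε0 (by linarith))) hq0)) hq0
  · refine ⟨continuous_iff_continuousAt.2 fun x => (hd0 x).continuousAt, ?_⟩
    -- The constant comes from `cosh (A x) ≥ 1 + A² x² / 2 ≥ min 1 (A² / 2) * (1 + x²)`.
    set κ := (cosh α - 1) * min 1 (rate α ^ 2 / 2) with hκ
    have hκ0 : 0 < κ := mul_pos (by linarith) (lt_min one_pos (by positivity))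
    refine ⟨sinh α ^ 2 / κ, fun x => ?_⟩
    have h1 : κ * (1 + x ^ 2) ≤ |1 + ε * cosh α * cosh (rate α * x)| := by
      refine le_trans ?_ (abs_denominator_ge hα hε x)
      rw [hκ, mul_assoc]
      refine mul_le_mul_of_nonneg_left (le_trans ?_ (one_add_sq_div_two_le_cosh _)) (by linarith)
      have m1 := min_le_left 1 (rate α ^ 2 / 2)
      have m2 := min_le_right 1 (rate α ^ 2 / 2)
      have m3 := mul_le_mul_of_nonneg_right m2 (sq_nonneg x)
      linarith [mul_pow (rate α) x 2]
    rw [profile, abs_div, abs_of_nonneg (sq_nonneg (sinh α)), ← div_eq_mul_inv, div_div]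
    gcongr

lemma uPlus_eq (α : ℝ) : uPlus α = fun x => psi0 α * (1 + 2 * profile α 1 x) := by
  funext x
  rw [uPlus, profile, mul_div_assoc, one_mul]

lemma uMinus_eq (α : ℝ) : uMinus α = fun x => psi0 α * (1 + 2 * profile α (-1) x) := by
  funext x
  rw [uMinus, profile, mul_div_assoc, neg_one_mul, neg_mul, ← sub_eq_add_neg]

lemma profile_one_pos {α : ℝ} (hα : 0 < α) (x : ℝ) : 0 < profile α 1 x := by
  have hs : 0 < sinh α := Real.sinh_pos_iff.2 hα
  have := Real.cosh_pos α
  have := Real.cosh_pos (rate α * x)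
  unfold profile
  positivity

lemma profile_neg_one_neg {α : ℝ} (hα : 0 < α) (x : ℝ) : profile α (-1) x < 0 := by
  have hs : 0 < sinh α := Real.sinh_pos_iff.2 hα
  have h1 := Real.one_lt_cosh.2 hα.ne'
  have h2 := Real.one_le_cosh (rate α * x)
  refine div_neg_of_pos_of_neg (by positivity) ?_
  nlinarith

theorem spectral_of_isProfile {ψ s : ℝ} {q q₁ : ℝ → ℝ} (h : IsProfile ψ s q q₁) {u : ℝ → ℝ}
    (hu : u = fun x => ψ * (1 + 2 * q x)) :
    (∀ L ∈ ({LPlus u, LMinus u} : Set (L2 →ₗ.[ℂ] L2)),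
      L.domain = H2 ∧ IsSelfAdjoint L ∧
      essentialSpectrum L ⊆ (fun t : ℝ => (t : ℂ)) '' Set.Ioi 0) ∧
    (∃ v : (LPlus u).domain,
      (((v : L2) : ℝ → ℂ) =ᵐ[volume] fun x => ((deriv u x : ℝ) : ℂ)) ∧ LPlus u v = 0) ∧
    0 ∈ pointSpectrum (LPlus u) := by
  have hd : ∀ x, deriv u x = ψ * (2 * q₁ x) := fun x => by
    rw [hu]
    exact ((((h.hasDerivAt x).const_mul 2).const_add 1).const_mul ψ).deriv
  simp only [hd]
  subst hu
  refine ⟨?_, h.exists_kernel_LPlus, h.zero_mem_pointSpectrum_LPlus⟩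
  rintro L (rfl | rfl)
  · exact h.spectral h.six_lt
  · exact h.spectral h.two_lt

/-! ### The pump strength -/

lemma pump_pos (α : ℝ) : 0 < pump α := by
  have := Real.cosh_pos α
  unfold pump
  positivity

lemma pump_sq (α : ℝ) : pump α ^ 2 = 2 * (cosh α ^ 2) ^ 2 / (1 + 2 * cosh α ^ 2) ^ 3 := by
  have h : 0 ≤ 1 + 2 * cosh α ^ 2 := by positivity
  rw [pump, div_pow, mul_pow, Real.sq_sqrt (by norm_num), ← Real.rpow_natCast (_ ^ (3 / 2 : ℝ)),
    ← Real.rpow_mul h]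
  norm_num

/-- After squaring, with `t = cosh² a` and `r = cosh² b`, the difference of the cross products is
twice `(r - t)(8t²r² - 6tr - (t + r))`. -/
lemma pump_lt_pump {a b : ℝ} (ha : 0 ≤ a) (hab : a < b) : pump b < pump a := by
  refine lt_of_pow_lt_pow_left₀ 2 (pump_pos a).le ?_
  rw [pump_sq, pump_sq]
  have h1 : 1 ≤ cosh a ^ 2 := one_le_pow₀ (Real.one_le_cosh a)
  have hlt : cosh a ^ 2 < cosh b ^ 2 := pow_lt_pow_left₀
    (Real.cosh_lt_cosh.2 (by rwa [abs_of_nonneg ha, abs_of_pos (ha.trans_lt hab)]))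
    (Real.cosh_pos a).le two_ne_zero
  generalize cosh a ^ 2 = t at *
  generalize cosh b ^ 2 = r at *
  have ht : 0 < t := by linarith
  have hr : 0 < r := by linarith
  rw [div_lt_div_iff₀ (by positivity) (by positivity)]
  have h2 : 1 < t * r := by nlinarith
  -- `(t - 1)(r - 1) ≥ 0` gives `t + r ≤ 1 + tr`, and `8x² - 7x - 1 = (8x + 1)(x - 1)` is positive
  -- at `x = tr > 1`.
  have h3 : 0 < 8 * (t * r) ^ 2 - 6 * (t * r) - (t + r) := by
    have : t + r ≤ 1 + t * r := by nlinarith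
    nlinarith
  have h4 := mul_pos (sub_pos.2 hlt) h3
  nlinarith

lemma continuous_pump : Continuous pump := by
  refine Continuous.div (by fun_prop) (Continuous.rpow_const (by fun_prop) fun α => Or.inr (by
    norm_num)) fun α => ?_
  have : 0 < 1 + 2 * cosh α ^ 2 := by positivity
  exact (Real.rpow_pos_of_pos this _).ne'

lemma pump_zero : pump 0 = 2 / (3 * √6) := by
  have h0 : 0 ≤ 2 / (3 * √6) := by positivity
  refine (pow_left_inj₀ (pump_pos 0).le h0 two_ne_zero).1 ?_
  rw [pump_sq, Real.cosh_zero, div_pow, mul_pow, Real.sq_sqrt (by norm_num)]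
  norm_num

theorem existsUnique_pump {h : ℝ} (hh : h ∈ Set.Ioo 0 (2 / (3 * √6))) :
    ∃! α : ℝ, 0 < α ∧ h = pump α := by
  obtain ⟨h0, h1⟩ := hh
  -- The square of the pump is below `1 / (4 cosh²)`, so a point with `cosh² b > 1 / h²` is far
  -- enough; this holds since `cosh² b ≥ cosh b ≥ b`.
  set b : ℝ := 1 + 1 / h ^ 2 with hb
  have hb0 : 0 < b := by positivity
  have hbh : pump b < h := by
    refine lt_of_pow_lt_pow_left₀ 2 h0.le ?_
    rw [pump_sq]
    have hc : 1 / h ^ 2 < cosh b ^ 2 := by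
      have := one_add_sq_div_two_le_cosh b
      have h2 : b ≤ cosh b := by nlinarith [sq_nonneg (b - 1)]
      have h3 := Real.one_le_cosh b
      nlinarith
    rw [div_lt_iff₀ (by positivity)] at hc
    generalize cosh b ^ 2 = t at *
    have ht : 0 < t := by
      by_contra hcon
      nlinarith [pow_pos h0 2]
    rw [div_lt_iff₀ (by positivity)]
    have : 0 < h ^ 2 := by positivity
    nlinarith [mul_pos this ht, mul_pos this (pow_pos ht 2), pow_pos ht 2]
  obtain ⟨α, hα, he⟩ := intermediate_value_Icc' hb0.le continuous_pump.continuousOn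
    ⟨hbh.le, (h1.trans_eq pump_zero.symm).le⟩
  have hα0 : 0 < α := by
    refine lt_of_le_of_ne hα.1 fun h2 => ?_
    rw [← h2, pump_zero] at he
    exact h1.ne he.symm
  refine ⟨α, ⟨hα0, he.symm⟩, fun β hβ => ?_⟩
  rcases lt_trichotomy β α with hlt | heq | hlt
  · have := pump_lt_pump hβ.1.le hlt
    rw [he, ← hβ.2] at this
    exact absurd this (lt_irrefl _)
  · exact heq
  · have := pump_lt_pump hα0.le hlt
    rw [he, ← hβ.2] at this
    exact absurd this (lt_irrefl _)

end Soliton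

end BBZ

end

theorem proposition2p3 (h : ℝ) (hh : h ∈ Set.Ioo 0 (2 / (3 * √6))) :
    (∃! α : ℝ, 0 < α ∧ h = BBZ.pump α) ∧
    ∀ α : ℝ, 0 < α → h = BBZ.pump α →
      (∀ u ∈ ({BBZ.uPlus α, BBZ.uMinus α} : Set (ℝ → ℝ)),
        (∀ L ∈ ({BBZ.LPlus u, BBZ.LMinus u} : Set (BBZ.L2 →ₗ.[ℂ] BBZ.L2)),
          L.domain = BBZ.H2 ∧ IsSelfAdjoint L ∧
          BBZ.essentialSpectrum L ⊆ (fun t : ℝ => (t : ℂ)) '' Set.Ioi 0) ∧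
        (∃ v : (BBZ.LPlus u).domain,
          (((v : BBZ.L2) : ℝ → ℂ) =ᵐ[volume] fun x => ((deriv u x : ℝ) : ℂ)) ∧
          BBZ.LPlus u v = 0) ∧
        0 ∈ BBZ.pointSpectrum (BBZ.LPlus u)) ∧
      (BBZ.morseIndex (BBZ.LPlus (BBZ.uPlus α)) = 1 ∧
        BBZ.IsPositiveOp (BBZ.LMinus (BBZ.uPlus α))) ∧
      (BBZ.morseIndex (BBZ.LPlus (BBZ.uMinus α)) = 1 ∧
        BBZ.morseIndex (BBZ.LMinus (BBZ.uMinus α)) = 1 ∧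
        ¬ BBZ.IsEigenvalue (BBZ.LMinus (BBZ.uMinus α)) 0) := by
  refine ⟨BBZ.existsUnique_pump hh, fun α hα _ => ?_⟩
  have hp := BBZ.isProfile hα (Or.inl rfl : (1 : ℝ) = 1 ∨ (1 : ℝ) = -1)
  have hm := BBZ.isProfile hα (Or.inr rfl : (-1 : ℝ) = 1 ∨ (-1 : ℝ) = -1)
  refine ⟨?_, ?_, ?_⟩
  · rintro u (rfl | rfl)
    · exact BBZ.spectral_of_isProfile hp (BBZ.uPlus_eq α)
    · exact BBZ.spectral_of_isProfile hm (BBZ.uMinus_eq α)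
  · rw [BBZ.uPlus_eq]
    exact ⟨hp.morseIndex_LPlus, hp.isPositiveOp_LMinus (BBZ.profile_one_pos hα)⟩
  · rw [BBZ.uMinus_eq]
    exact ⟨hm.morseIndex_LPlus, hm.morseIndex_LMinus (BBZ.profile_neg_one_neg hα)⟩
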